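/- Let $\mathcal X$ be a complex Banach space, $T>0$, and let $\mathcal A$ be a closed, densely defined linear operator in $\mathcal X$ with bounded inverse ($0\in\rho(\mathcal A)$). Let $\mathcal U(t,s)\in B(\mathcal X)$, $t,s\in[0,T]$, be an evolution operator of $u''=\mathcal A u$ on $[0,T]$: $\mathcal U$ is strongly continuous, $\mathcal U(s,s)=I$, $\mathcal U(t,s)=\mathcal U(t,r)\,\mathcal U(r,s)$ for $0\le s\le r\le t<T$, the strong derivative $\mathcal V(t,s):=\partial_t\mathcal U(t,s)$ exists, is bounded on $\mathcal X$ and is strongly continuous, and for $x\in D(\mathcal A)$ one has $\mathcal U(t,s)x\in D(\mathcal A)$ and $\partial_t^2\,\mathcal U(t,s)x=\mathcal A\,\mathcal U(t,s)x$. Assume that $\partial_t\mathcal U(t,s)$ and $\partial_t\mathcal V(t,s)=\partial_t^2\mathcal U(t,s)$ are sectorial for all $t,s\in[0,T]$. Here a closed densely defined operator $M$ is sectorial if, for some $\omega\in[0,\pi)$, its spectrum lies in the closed sector $\{|\arg z|\le\omega\}$ (together with $0$) and $\|z(z-M)^{-1}\|$ is bounded on $\{|\arg z|>\omega'\}$ for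 every $\omega'\in(\omega,\pi)$. Fix $t,s\in[0,T]$ such that $\mathcal U(t,s)$, $\partial_t\mathcal U(t,s)$ and $\partial_t^2\mathcal U(t,s)$ commute with each other, and $\kappa\in\mathbb C$. Put $\alpha(t,s)=\mathrm{Log}(\mathcal U(t,s)+\kappa I)$ and $\hat\alpha(t,s)=\mathrm{Log}(\mathcal V(t,s)+\kappa I)$, where $\mathrm{Log}$ is the principal branch of the logarithm, defined by the Riesz–Dunford integral. Assume that the factors below are well defined at $(t,s)$: the spectra of $\mathcal U(t,s)+\kappa I$ and of $\mathcal V(t,s)+\kappa I$ do not meet $(-\infty,0]$, and $I-\kappa e^{-\alpha(t,s)}$ and $I-\kappa e^{-\hat\alpha(t,s)}$ have bounded inverses. Let $P$ be either of the two operator products (on their natural domains, with $\partial_t$ the strong derivative) $$(I-\kappa e^{-\hat\alpha})^{-1}\partial_t\hat\alpha\,(I-\kappa e^{-\alpha})^{-1}\partial_t\alpha,\qquad (I-\kappa e^{-\alpha})^{-1}\partial_t\alpha\,(I-\kappa e^{-\hat\alpha})^{-1}\partial_t\hat\alpha$$ at $(t,s)$. Then $P=\mathcal A$, the square root $\mathcal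 A^{1/2}=P^{1/2}$ of the sectorial operator $P$ (closure of the Balakrishnan operator $x\mapsto\frac1\pi\int_0^\infty r^{-1/2}(r+P)^{-1}Px\,dr$ on $D(P)$) satisfies $P^{1/2}P^{1/2}=\mathcal A$, and both $+P^{1/2}$ and $-P^{1/2}$ are infinitesimal generators of $C_0$-semigroups $\exp[\pm\tau\mathcal A^{1/2}]$, $\tau\ge0$. Moreover, for every solution $u$ of $u''=\mathcal A u$ on $[0,T]$, and in particular for $u(\tau)=\mathcal U(\tau,r)u_0$ with any $r\in[0,T]$ and $u_0\in\mathcal X$, there are $u_+,u_-\in\mathcal X$ with $$u(\tau)=\exp[+\tau\mathcal A^{1/2}]\,u_+ + \exp[-\tau\mathcal A^{1/2}]\,u_-\qquad(0\le\tau\le T).$$ -/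

import Mathlib

open Set MeasureTheory

noncomputable section

variable {X : Type*} [NormedAddCommGroup X] [NormedSpace ℂ X]

/-! ### Unbounded operators -/

/-- `R` is the bounded everywhere defined inverse `(z - M)⁻¹` of the unbounded operator `z - M`. -/
def IsResolvent (M : X →ₗ.[ℂ] X) (z : ℂ) (R : X →L[ℂ] X) : Prop :=
  (∀ x : X, ∃ h : R x ∈ M.domain, z • R x - M ⟨R x, h⟩ = x) ∧
    ∀ y : M.domain, R (z • (y : X) - M y) = y

open Classical in
/-- The resolvent `(z - M)⁻¹` (it is `0` by convention when `z` is in the spectrum of `M`). -/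
def unboundedResolvent (M : X →ₗ.[ℂ] X) (z : ℂ) : X →L[ℂ] X :=
  if h : ∃ R : X →L[ℂ] X, IsResolvent M z R then h.choose else 0

/-- Sectorial operators (vertex `0`, semi-angle `ω < π`): closed and densely defined, the spectrum
lies in the closed sector `|arg z| ≤ ω`, and `z (z - M)⁻¹` is uniformly bounded outside every
larger sector. -/
def IsSectorial (M : X →ₗ.[ℂ] X) : Prop :=
  M.IsClosed ∧ Dense (M.domain : Set X) ∧
    ∃ ω : ℝ, 0 ≤ ω ∧ ω < Real.pi ∧ ∀ ω' : ℝ, ω < ω' → ω' < Real.pi →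
      ∃ C : ℝ, ∀ z : ℂ, ω' < |z.arg| → ∃ R : X →L[ℂ] X, IsResolvent M z R ∧ ‖z • R‖ ≤ C

/-- The product `M N` of unbounded operators on its natural domain
`{x ∈ D(N) : N x ∈ D(M)}`. -/
def opProduct (M N : X →ₗ.[ℂ] X) : X →ₗ.[ℂ] X where
  domain :=
    { carrier := {x | ∃ h : x ∈ N.domain, N ⟨x, h⟩ ∈ M.domain}
      zero_mem' := ⟨N.domain.zero_mem, by
        rw [show (⟨0, N.domain.zero_mem⟩ : N.domain) = 0 from rfl, LinearPMap.map_zero]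
        exact M.domain.zero_mem⟩
      add_mem' := by
        rintro x y ⟨hx, hx'⟩ ⟨hy, hy'⟩
        refine ⟨N.domain.add_mem hx hy, ?_⟩
        rw [show (⟨x + y, N.domain.add_mem hx hy⟩ : N.domain) = ⟨x, hx⟩ + ⟨y, hy⟩ from rfl,
          LinearPMap.map_add]
        exact M.domain.add_mem hx' hy'
      smul_mem' := by
        rintro c x ⟨hx, hx'⟩
        refine ⟨N.domain.smul_mem c hx, ?_⟩
        rw [show (⟨c • x, N.domain.smul_mem c hx⟩ : N.domain) = c • ⟨x, hx⟩ from rfl,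
          LinearPMap.map_smul]
        exact M.domain.smul_mem c hx' }
  toFun :=
    { toFun := fun x => M ⟨N ⟨x, x.2.1⟩, x.2.2⟩
      map_add' := by
        rintro ⟨x, hx, hx'⟩ ⟨y, hy, hy'⟩
        rw [← LinearPMap.map_add]
        congr 1
        apply Subtype.ext
        exact LinearPMap.map_add N ⟨x, hx⟩ ⟨y, hy⟩
      map_smul' := by
        rintro c ⟨x, hx, hx'⟩
        rw [RingHom.id_apply, ← LinearPMap.map_smul]
        congr 1
        apply Subtype.ext
        exact LinearPMap.map_smul N c ⟨x, hx⟩ }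

/-- A bounded operator `K` commutes with an unbounded operator `M`: `K M ⊆ M K`. -/
def CommutesWith (K : X →L[ℂ] X) (M : X →ₗ.[ℂ] X) : Prop :=
  ∀ x : M.domain, ∃ h : K x ∈ M.domain, M ⟨K x, h⟩ = K (M x)

/-- The integrand `r ^ (-1/2) (r + M)⁻¹ M x` of the Balakrishnan formula. -/
def sqrtIntegrand (M : X →ₗ.[ℂ] X) (x : M.domain) (r : ℝ) : X :=
  r ^ (-(1 / 2) : ℝ) • -(unboundedResolvent M (-(r : ℂ)) (M x))

lemma sqrtIntegrand_add (M : X →ₗ.[ℂ] X) (x y : M.domain) :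
    sqrtIntegrand M (x + y) = fun r => sqrtIntegrand M x r + sqrtIntegrand M y r := by
  funext r
  simp only [sqrtIntegrand, LinearPMap.map_add, map_add, neg_add, smul_add]

lemma sqrtIntegrand_smul (M : X →ₗ.[ℂ] X) (c : ℂ) (x : M.domain) :
    sqrtIntegrand M (c • x) = fun r => c • sqrtIntegrand M x r := by
  funext r
  simp only [sqrtIntegrand, LinearPMap.map_smul, map_smul, ← smul_neg]
  rw [smul_comm]

/-- The Balakrishnan operator `x ↦ π⁻¹ ∫₀^∞ r ^ (-1/2) (r + M)⁻¹ M x dr`, on those `x ∈ D(M)` for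
which the integral converges (all of `D(M)` when `M` is sectorial). -/
def balakrishnan (M : X →ₗ.[ℂ] X) : X →ₗ.[ℂ] X where
  domain :=
    { carrier := {x | ∃ h : x ∈ M.domain, IntegrableOn (sqrtIntegrand M ⟨x, h⟩) (Ioi 0)}
      zero_mem' := ⟨M.domain.zero_mem, by
        have h0 : sqrtIntegrand M ⟨0, M.domain.zero_mem⟩ = fun _ => (0 : X) := by
          funext r
          rw [sqrtIntegrand, show (⟨0, M.domain.zero_mem⟩ : M.domain) = 0 from rfl,
            LinearPMap.map_zero]
          simp
        rw [h0]
        exact integrableOn_zero⟩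
      add_mem' := by
        rintro x y ⟨hx, hx'⟩ ⟨hy, hy'⟩
        refine ⟨M.domain.add_mem hx hy, ?_⟩
        have := sqrtIntegrand_add M ⟨x, hx⟩ ⟨y, hy⟩
        exact this ▸ Integrable.add hx' hy'
      smul_mem' := by
        rintro c x ⟨hx, hx'⟩
        refine ⟨M.domain.smul_mem c hx, ?_⟩
        have := sqrtIntegrand_smul M c ⟨x, hx⟩
        exact this ▸ Integrable.smul c hx' }
  toFun :=
    { toFun := fun x => (Real.pi⁻¹ : ℝ) • ∫ r in Ioi (0 : ℝ), sqrtIntegrand M ⟨x, x.2.1⟩ r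
      map_add' := by
        rintro ⟨x, hx, hx'⟩ ⟨y, hy, hy'⟩
        have := sqrtIntegrand_add M ⟨x, hx⟩ ⟨y, hy⟩
        rw [← smul_add, ← integral_add hx' hy']
        exact congrArg (fun f : ℝ → X => (Real.pi⁻¹ : ℝ) • ∫ r in Ioi (0 : ℝ), f r) this
      map_smul' := by
        rintro c ⟨x, hx, hx'⟩
        have := sqrtIntegrand_smul M c ⟨x, hx⟩
        rw [RingHom.id_apply, smul_comm c, ← integral_smul c]
        exact congrArg (fun f : ℝ → X => (Real.pi⁻¹ : ℝ) • ∫ r in Ioi (0 : ℝ), f r) this }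

/-- The square root `M ^ (1/2)` of a sectorial operator: the closure of the Balakrishnan
operator. -/
def opSqrt (M : X →ₗ.[ℂ] X) : X →ₗ.[ℂ] X :=
  (balakrishnan M).closure

/-! ### Strong derivatives and one-parameter semigroups -/

/-- The strong derivative at `t` (relative to the parameter set `I`) of a family of bounded
operators: the generally unbounded operator `x ↦ d/dr (F r x)` at `r = t`, with domain the set of
all `x` for which this derivative exists. -/
def strongDeriv (F : ℝ → X →L[ℂ] X) (I : Set ℝ) (t : ℝ) : X →ₗ.[ℂ] X where
  domain :=
    { carrier := {x | DifferentiableWithinAt ℝ (fun r => F r x) I t}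
      zero_mem' := by
        simpa only [mem_ofPred_eq, map_zero] using
          differentiableWithinAt_const (𝕜 := ℝ) (0 : X)
      add_mem' := by
        intro x y hx hy
        simpa only [mem_ofPred_eq, map_add] using DifferentiableWithinAt.fun_add hx hy
      smul_mem' := by
        intro c x hx
        simpa only [mem_ofPred_eq, map_smul] using DifferentiableWithinAt.fun_const_smul hx c }
  toFun :=
    { toFun := fun x => derivWithin (fun r => F r x) I t
      map_add' := by
        rintro ⟨x, hx⟩ ⟨y, hy⟩
        simp only [Submodule.coe_add, map_add]
        exact derivWithin_fun_add hx hy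
      map_smul' := by
        rintro c ⟨x, hx⟩
        simp only [Submodule.coe_smul, map_smul]
        exact derivWithin_fun_const_smul c hx }

/-- `S` is the one-parameter `C₀`-semigroup `S τ = exp (τ B)`, `τ ≥ 0`, with infinitesimal
generator `B` (domains included). -/
structure IsSemigroupGeneratedBy (B : X →ₗ.[ℂ] X) (S : ℝ → X →L[ℂ] X) : Prop where
  map_zero : S 0 = 1
  map_add : ∀ r τ : ℝ, 0 ≤ r → 0 ≤ τ → S (r + τ) = S r * S τ
  strong_cont : ∀ x : X, ContinuousOn (fun τ => S τ x) (Ici 0)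
  generator : strongDeriv S (Ici 0) 0 = B

/-! ### The principal logarithm of a bounded operator -/

/-- The open annular sector `{e ^ w : a < Re w < b, |Im w| < θ}`. -/
def annularSector (a b θ : ℝ) : Set ℂ :=
  Complex.exp '' {w : ℂ | a < w.re ∧ w.re < b ∧ |w.im| < θ}

/-- The Riesz-Dunford integral `(2πi)⁻¹ ∮ Log z (z - M)⁻¹ dz` over the positively oriented boundary
of `annularSector a b θ`, where `θ < π`. The boundary is parametrized by `z = e ^ w`, with `w` on
the boundary of a rectangle, so that `Log z = w` and `dz = e ^ w dw`. -/
def rieszDunfordLog (M : X →L[ℂ] X) (a b θ : ℝ) : X →L[ℂ] X :=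
  let g : ℂ → X →L[ℂ] X := fun w => (w * Complex.exp w) • resolvent M (Complex.exp w)
  (2 * Real.pi * Complex.I)⁻¹ •
    ((∫ x in a..b, g (x + ((-θ : ℝ) : ℂ) * Complex.I)) - (∫ x in a..b, g (x + θ * Complex.I)) +
      Complex.I • (∫ y in (-θ)..θ, g (b + y * Complex.I)) -
      Complex.I • (∫ y in (-θ)..θ, g (a + y * Complex.I)))

open Classical in
/-- The principal logarithm of a bounded operator whose spectrum does not meet `(-∞, 0]`: the
Riesz-Dunford integral over a contour in the slit plane that surrounds the spectrum (by Cauchy's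
theorem it does not depend on the contour). -/
def opLog (M : X →L[ℂ] X) : X →L[ℂ] X :=
  if h : ∃ p : ℝ × ℝ × ℝ, p.1 < p.2.1 ∧ 0 < p.2.2 ∧ p.2.2 < Real.pi ∧
      spectrum ℂ M ⊆ annularSector p.1 p.2.1 p.2.2 then
    rieszDunfordLog M h.choose.1 h.choose.2.1 h.choose.2.2
  else 0

/-- `α(r) = Log (F(r) + κ I)`. -/
def shiftedLog (κ : ℂ) (F : ℝ → X →L[ℂ] X) (r : ℝ) : X →L[ℂ] X :=
  opLog (F r + κ • (1 : X →L[ℂ] X))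

/-- The bounded operator `I - κ e ^ (-α(t))`, where `α = Log (F + κ I)`. -/
def logFactor (κ : ℂ) (F : ℝ → X →L[ℂ] X) (t : ℝ) : X →L[ℂ] X :=
  1 - κ • NormedSpace.exp (-(shiftedLog κ F t))

/-- The logarithmic representation `∂ₜ Log F(t) := (I - κ e ^ (-α(t)))⁻¹ ∂ₜ α(t)`, where
`α = Log (F + κ I)`, with domain `D(∂ₜ α(t))`. -/
def logRepresentation (κ : ℂ) (F : ℝ → X →L[ℂ] X) (I : Set ℝ) (t : ℝ) : X →ₗ.[ℂ] X :=
  (Ring.inverse (logFactor κ F t)).toLinearMap.compPMap (strongDeriv (shiftedLog κ F) I t)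

/-- The logarithmic representation of `F` at `t` is well defined: the spectrum of `F(t) + κ I` does
not meet the cut `(-∞, 0]` of the logarithm, and `I - κ e ^ (-α(t))` has a bounded inverse. -/
def LogRepresentationDefined (κ : ℂ) (F : ℝ → X →L[ℂ] X) (t : ℝ) : Prop :=
  spectrum ℂ (F t + κ • (1 : X →L[ℂ] X)) ⊆ Complex.slitPlane ∧ IsUnit (logFactor κ F t)

/-! ### The second order abstract Cauchy problem -/

/-- `u` is a solution of `u'' = A u` on `[0, T]`. -/
def IsSolution (A : X →ₗ.[ℂ] X) (T : ℝ) (u : ℝ → X) : Prop :=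
  ∃ v : ℝ → X, ∀ t ∈ Icc 0 T, HasDerivWithinAt u (v t) (Icc 0 T) t ∧
    ∃ h : u t ∈ A.domain, HasDerivWithinAt v (A ⟨u t, h⟩) (Icc 0 T) t

/-- `U(t,s)` is an evolution operator of `u'' = A u` on `[0, T]`, with bounded, strongly continuous
first derivative `V(t,s) = ∂ₜ U(t,s)`: for data `x` in the domain of `A`, the function
`t ↦ U(t,s) x` is a solution. -/
structure IsEvolutionOperator (A : X →ₗ.[ℂ] X) (T : ℝ) (U V : ℝ → ℝ → X →L[ℂ] X) : Prop where
  strong_cont : ∀ x : X, ContinuousOn (fun p : ℝ × ℝ => U p.1 p.2 x) (Icc 0 T ×ˢ Icc 0 T)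
  map_self : ∀ s ∈ Icc 0 T, U s s = 1
  semigroup : ∀ t r s : ℝ, 0 ≤ s → s ≤ r → r ≤ t → t < T → U t s = U t r * U r s
  deriv : ∀ t ∈ Icc 0 T, ∀ s ∈ Icc 0 T, ∀ x : X,
    HasDerivWithinAt (fun r => U r s x) (V t s x) (Icc 0 T) t
  deriv_strong_cont : ∀ x : X,
    ContinuousOn (fun p : ℝ × ℝ => V p.1 p.2 x) (Icc 0 T ×ˢ Icc 0 T)
  equation : ∀ t ∈ Icc 0 T, ∀ s ∈ Icc 0 T, ∀ x ∈ A.domain,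
    ∃ h : U t s x ∈ A.domain,
      HasDerivWithinAt (fun r => V r s x) (A ⟨U t s x, h⟩) (Icc 0 T) t

end

/-!
Although `A` is only assumed to be closed, the hypotheses force it to be bounded: the derivative
`V = ∂ₜ U` is bounded on `[0, T]²` by the uniform boundedness principle, so `U(r,0)` is Lipschitz in
norm and close to `I` for small `r`. Integrating `V' = A U` over a short interval `[0, h]` gives
`A⁻¹ (V(h,0) - V(0,0)) / h ≈ I` in norm, so `A⁻¹` is onto
(`IsEvolutionOperator.exists_eq_ofBounded`). Consequently `U(·,s)` and `V(·,s)` are differentiable in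
norm, with derivatives `V` and `A U`, and everything takes place in the Banach algebra of bounded
operators. At `t = s` the sectorial operator `∂ₜ² U(s,s)` is `A` itself, so the spectrum of `A` does
not meet `(-∞, 0]`.

Functional calculus is done through the resolvents `(1 + τ N)⁻¹`, `0 ≤ τ ≤ 1`, on a segment
(`segInv`), which exist for `1 + N` without spectrum on `(-∞, 0]`.

* The Riesz-Dunford integral of the logarithm of `M` is `∫₀¹ (M - 1) (1 + τ (M - 1))⁻¹ dτ`
  (`segLog`), for every admissible contour: `Log z` minus this operator is `(z - M)` times a function
  holomorphic on the slit plane, to which Cauchy's theorem applies (`rectInt_log_resolvent`), and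
  `∮ (z - M)⁻¹ dz = 2πi` (`rectInt_exp_smul_resolvent`). The integral formula gives the derivative
  `F' (F + κ)⁻¹` of `Log (F + κ)` when `F` and `F'` commute (`hasDerivWithinAt_segLog`) and
  `exp (-Log M) = M⁻¹` (`exp_neg_segLog`). So the logarithmic representation of `F` is `F⁻¹ F'`
  (`logRepresentation_eq_ofBounded`), and the two products are `V⁻¹ A U U⁻¹ V` and `U⁻¹ V V⁻¹ A U`.
  Both equal `A`, which commutes with `U` and `V`.
* The substitution `r = tan²φ` turns the Balakrishnan integral of `A` into
  `(2/π) ∫₀^{π/2} (1 + cos²φ (A - 1))⁻¹ A dφ` (`opSqrt_ofBounded`). Its square is `A`, since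
  `(1 + σ N)^(-1/2)` satisfies the expected differential equation in `σ` (`segInvSqrt_mul_self`).

The square root `S` is thus bounded and invertible, `exp (±τ S)` are its groups, and a solution of
`u'' = S² u` splits into the solutions `u' ± S u` of first order equations (`exists_decomposition`).
-/

open Filter Topology

/-! ### Resolvents along a segment -/

section BanachAlgebra

variable {𝔸 : Type*} [NormedRing 𝔸] [NormedAlgebra ℂ 𝔸]

/-- The inverse `(1 + τ N)⁻¹` (`0` if `1 + τ N` is not invertible). -/
noncomputable def segInv (N : 𝔸) (τ : ℝ) : 𝔸 := Ring.inverse (1 + (τ : ℂ) • N)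

/-- All points `1 + τ N`, `0 ≤ τ ≤ 1`, of the segment from `1` to `1 + N` are invertible. -/
def SegUnit (N : 𝔸) : Prop := ∀ τ ∈ Icc (0 : ℝ) 1, IsUnit (1 + (τ : ℂ) • N)

lemma mul_segInv {N : 𝔸} (hN : SegUnit N) {τ : ℝ} (hτ : τ ∈ Icc (0 : ℝ) 1) :
    (1 + (τ : ℂ) • N) * segInv N τ = 1 :=
  Ring.mul_inverse_cancel _ (hN τ hτ)

lemma segInv_mul {N : 𝔸} (hN : SegUnit N) {τ : ℝ} (hτ : τ ∈ Icc (0 : ℝ) 1) :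
    segInv N τ * (1 + (τ : ℂ) • N) = 1 :=
  Ring.inverse_mul_cancel _ (hN τ hτ)

lemma commute_ringInverse {R : Type*} [MonoidWithZero R] {a b : R} (h : Commute a b) :
    Commute a (Ring.inverse b) := by
  by_cases hb : IsUnit b
  · obtain ⟨u, rfl⟩ := hb
    rw [Ring.inverse_unit]
    exact h.units_inv_right
  · rw [Ring.inverse_non_unit _ hb]
    exact Commute.zero_right a

lemma commute_segInv {B N : 𝔸} (h : Commute B N) (τ : ℝ) : Commute B (segInv N τ) :=
  commute_ringInverse ((Commute.one_right B).add_right (h.smul_right _))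

lemma SegUnit.smul {N : 𝔸} (hN : SegUnit N) {σ : ℝ} (hσ : σ ∈ Icc (0 : ℝ) 1) :
    SegUnit ((σ : ℂ) • N) := by
  intro τ hτ
  rw [smul_smul, ← Complex.ofReal_mul]
  exact hN _ ⟨mul_nonneg hτ.1 hσ.1, mul_le_one₀ hτ.2 hσ.1 hσ.2⟩

/-- The resolvent identity along a segment. -/
lemma segInv_sub_segInv {N N' : 𝔸} {τ : ℝ} (hτ : τ ∈ Icc (0 : ℝ) 1) (hN : SegUnit N)
    (hN' : SegUnit N') :
    segInv N' τ - segInv N τ = -((τ : ℂ) • (segInv N' τ * (N' - N) * segInv N τ)) := by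
  have h1 := segInv_mul hN' hτ
  have h2 := mul_segInv hN hτ
  calc segInv N' τ - segInv N τ
      = segInv N' τ * ((1 + (τ : ℂ) • N) * segInv N τ)
        - segInv N' τ * (1 + (τ : ℂ) • N') * segInv N τ := by rw [h1, h2, mul_one, one_mul]
    _ = _ := by
      simp only [mul_add, add_mul, mul_sub, sub_mul, mul_one, one_mul, mul_smul_comm,
        smul_mul_assoc, smul_sub, mul_assoc]
      abel

/-- The resolvent identity for `N (1 + τ N)⁻¹`. -/
lemma mul_segInv_sub {N N' : 𝔸} {τ : ℝ} (hτ : τ ∈ Icc (0 : ℝ) 1) (hN : SegUnit N)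
    (hN' : SegUnit N') :
    N' * segInv N' τ - N * segInv N τ = segInv N' τ * (N' - N) * segInv N τ := by
  have h1 := segInv_mul hN' hτ
  have h2 := mul_segInv hN hτ
  have h3 : N' * segInv N' τ = segInv N' τ * N' := commute_segInv (Commute.refl N') τ
  calc N' * segInv N' τ - N * segInv N τ
      = segInv N' τ * N' * ((1 + (τ : ℂ) • N) * segInv N τ)
        - segInv N' τ * (1 + (τ : ℂ) • N') * N * segInv N τ := by rw [h1, h2, h3, mul_one, one_mul]
    _ = _ := by
      simp only [mul_add, add_mul, mul_sub, sub_mul, mul_one, one_mul, mul_smul_comm,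
        smul_mul_assoc, mul_assoc]
      abel

variable [CompleteSpace 𝔸]

lemma continuousAt_segInv {N : 𝔸} (hN : SegUnit N) {τ : ℝ} (hτ : τ ∈ Icc (0 : ℝ) 1) :
    ContinuousAt (fun p : 𝔸 × ℝ => segInv p.1 p.2) (N, τ) := by
  obtain ⟨u, hu⟩ := hN τ hτ
  have h1 : ContinuousAt (fun p : 𝔸 × ℝ => 1 + (p.2 : ℂ) • p.1) (N, τ) := by fun_prop
  have h2 := NormedRing.inverse_continuousAt u
  rw [hu] at h2
  exact ContinuousAt.comp (g := Ring.inverse) (f := fun p : 𝔸 × ℝ => 1 + (p.2 : ℂ) • p.1) h2 h1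

lemma continuousOn_segInv {N : 𝔸} (hN : SegUnit N) : ContinuousOn (segInv N) (Icc 0 1) := by
  intro τ hτ
  have h : ContinuousAt (fun τ : ℝ => (N, τ)) τ := by fun_prop
  exact (ContinuousAt.comp (g := fun p : 𝔸 × ℝ => segInv p.1 p.2) (f := fun τ => (N, τ))
    (continuousAt_segInv hN hτ) h).continuousWithinAt

/-- Invertibility along a segment is stable, and the inverses are locally uniformly bounded. -/
lemma SegUnit.eventually {N : 𝔸} (hN : SegUnit N) :
    ∃ C : ℝ, ∀ᶠ N' in 𝓝 N, SegUnit N' ∧ ∀ τ ∈ Icc (0 : ℝ) 1, ‖segInv N' τ‖ ≤ C := by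
  obtain ⟨C, hC⟩ := isCompact_Icc.exists_bound_of_continuousOn (continuousOn_segInv hN)
  refine ⟨C + 1, ?_⟩
  have key : ∀ᶠ N' in 𝓝 N, ∀ τ ∈ Icc (0 : ℝ) 1,
      IsUnit (1 + (τ : ℂ) • N') ∧ ‖segInv N' τ‖ ≤ C + 1 := by
    refine isCompact_Icc.eventually_forall_of_forall_eventually fun τ hτ => ?_
    have h1 : ContinuousAt (fun p : 𝔸 × ℝ => 1 + (p.2 : ℂ) • p.1) (N, τ) := by fun_prop
    refine (h1.eventually (Units.isOpen.mem_nhds (hN τ hτ))).and ?_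
    have h2 := (continuousAt_segInv hN hτ).norm
    exact (h2.eventually (gt_mem_nhds ((hC τ hτ).trans_lt (lt_add_one C)))).mono fun _ h => h.le
  exact key.mono fun N' h => ⟨fun τ hτ => (h τ hτ).1, fun τ hτ => (h τ hτ).2⟩

/-- Differentiation under the integral sign: a difference quotient of the perturbed inverses,
integrated over a compact interval, converges. -/
lemma hasDerivWithinAt_integral_segInv {𝕜 : Type*} [NontriviallyNormedField 𝕜]
    [NormedAlgebra 𝕜 𝔸] [SMulCommClass ℝ 𝕜 𝔸] {I : Set 𝕜} {t : 𝕜} {N : 𝕜 → 𝔸} {N' : 𝔸}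
    (hd : HasDerivWithinAt N N' I t) (hN : SegUnit (N t)) {p q : ℝ} {c : ℝ → ℝ} {m : ℝ → 𝔸}
    (hc : ContinuousOn c (uIcc p q)) (hc' : MapsTo c (uIcc p q) (Icc 0 1))
    (hm : ContinuousOn m (uIcc p q)) :
    HasDerivWithinAt
      (fun r => ∫ φ in p..q, segInv (N r) (c φ) * (N r - N t) * segInv (N t) (c φ) * m φ)
      (∫ φ in p..q, segInv (N t) (c φ) * N' * segInv (N t) (c φ) * m φ) I t := by
  rw [hasDerivWithinAt_iff_tendsto_slope]
  have hslope := hasDerivWithinAt_iff_tendsto_slope.1 hd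
  have hcont : Tendsto N (𝓝[I \ {t}] t) (𝓝 (N t)) :=
    hd.continuousWithinAt.tendsto.mono_left (nhdsWithin_mono _ sdiff_subset)
  obtain ⟨C, hC⟩ := hN.eventually
  have hCN := hC.self_of_nhds.2
  have hev := hcont.eventually hC
  obtain ⟨Cm, hCm⟩ := isCompact_uIcc.exists_bound_of_continuousOn hm
  have hbd : ∀ᶠ r in 𝓝[I \ {t}] t, ‖slope N t r‖ ≤ ‖N'‖ + 1 :=
    (hslope.norm.eventually (gt_mem_nhds (lt_add_one ‖N'‖))).mono fun _ h => h.le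
  have heq : ∀ r, slope (fun r => ∫ φ in p..q, segInv (N r) (c φ) * (N r - N t) *
      segInv (N t) (c φ) * m φ) t r =
      ∫ φ in p..q, segInv (N r) (c φ) * slope N t r * segInv (N t) (c φ) * m φ := by
    intro r
    simp only [slope, vsub_eq_sub, sub_self, mul_zero, zero_mul, intervalIntegral.integral_zero,
      sub_zero, mul_smul_comm, smul_mul_assoc]
    rw [intervalIntegral.integral_smul]
  refine Tendsto.congr (fun r => (heq r).symm) ?_
  have hcN : ∀ {N : 𝔸}, SegUnit N → ContinuousOn (fun φ => segInv N (c φ)) (uIcc p q) :=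
    fun h => (continuousOn_segInv h).comp hc hc'
  have hsub : uIoc p q ⊆ uIcc p q := uIoc_subset_uIcc
  refine intervalIntegral.tendsto_integral_filter_of_dominated_convergence
    (fun _ => C * (‖N'‖ + 1) * C * Cm) ?_ ?_ ?_ ?_
  · filter_upwards [hev] with r hr
    refine ContinuousOn.aestronglyMeasurable (ContinuousOn.mono ?_ hsub) measurableSet_uIoc
    exact (((hcN hr.1).mul continuousOn_const).mul (hcN hN)).mul hm
  · filter_upwards [hev, hbd] with r hr hr'
    refine Eventually.of_forall fun φ hφ => ?_
    have hφ' := hc' (hsub hφ)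
    have hC0 : 0 ≤ C := (norm_nonneg _).trans (hCN _ hφ')
    calc _ ≤ ‖segInv (N r) (c φ)‖ * ‖slope N t r‖ * ‖segInv (N t) (c φ)‖ * ‖m φ‖ :=
          (norm_mul_le _ _).trans (mul_le_mul_of_nonneg_right ((norm_mul_le _ _).trans
            (mul_le_mul_of_nonneg_right (norm_mul_le _ _) (norm_nonneg _))) (norm_nonneg _))
      _ ≤ _ := by
          gcongr
          exacts [hr.2 _ hφ', hCN _ hφ', hCm _ (hsub hφ)]
  · exact intervalIntegrable_const
  · refine Eventually.of_forall fun φ hφ => ?_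
    have hφ' := hc' (hsub hφ)
    have h1 : Tendsto (fun r => segInv (N r) (c φ)) (𝓝[I \ {t}] t) (𝓝 (segInv (N t) (c φ))) := by
      have : Tendsto (fun r => (N r, c φ)) (𝓝[I \ {t}] t) (𝓝 (N t, c φ)) := by
        rw [nhds_prod_eq]; exact hcont.prodMk tendsto_const_nhds
      exact (continuousAt_segInv hN hφ').tendsto.comp this
    exact ((h1.mul hslope).mul_const _).mul_const _

lemma intervalIntegral_mul_left {f : ℝ → 𝔸} {p q : ℝ} (hf : IntervalIntegrable f volume p q)
    (B : 𝔸) : ∫ φ in p..q, B * f φ = B * ∫ φ in p..q, f φ :=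
  ((ContinuousLinearMap.mul ℝ 𝔸) B).intervalIntegral_comp_comm hf

lemma intervalIntegral_mul_right {f : ℝ → 𝔸} {p q : ℝ} (hf : IntervalIntegrable f volume p q)
    (B : 𝔸) : ∫ φ in p..q, f φ * B = (∫ φ in p..q, f φ) * B :=
  ((ContinuousLinearMap.mul ℝ 𝔸).flip B).intervalIntegral_comp_comm hf

/-! ### The logarithm as an integral along a segment -/

/-- The principal logarithm of `1 + N`, written as `∫₀¹ N (1 + τ N)⁻¹ dτ`. -/
noncomputable def segLog (N : 𝔸) : 𝔸 := ∫ τ in (0 : ℝ)..1, N * segInv N τ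

lemma intervalIntegrable_mul_segInv {N : 𝔸} (hN : SegUnit N) (B : 𝔸) :
    IntervalIntegrable (fun τ => B * segInv N τ) volume 0 1 := by
  refine ContinuousOn.intervalIntegrable ?_
  rw [uIcc_of_le zero_le_one]
  exact continuousOn_const.mul (continuousOn_segInv hN)

lemma hasDerivAt_segInv {N : 𝔸} (hN : SegUnit N) {τ : ℝ} (hτ : τ ∈ Icc (0 : ℝ) 1) :
    HasDerivAt (segInv N) (-(segInv N τ * N * segInv N τ)) τ := by
  obtain ⟨u, hu⟩ := hN τ hτ
  have h1 : HasDerivAt (fun τ : ℝ => 1 + (τ : ℂ) • N) N τ := by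
    simpa using ((Complex.ofRealCLM.hasDerivAt (x := τ)).smul_const N).const_add 1
  have h2 := hasFDerivAt_ringInverse (𝕜 := ℝ) u
  rw [hu] at h2
  have h3 := h2.comp_hasDerivAt τ h1
  have h4 : segInv N τ = ↑u⁻¹ := by rw [segInv, ← hu, Ring.inverse_unit]
  rw [h4]
  refine (h3.congr_deriv ?_ : HasDerivAt (Ring.inverse ∘ fun τ : ℝ => 1 + (τ : ℂ) • N) _ τ)
  simp

/-- `∫₀¹ (1 + τ N)⁻² dτ = (1 + N)⁻¹`, as `d/dτ (τ (1 + τ N)⁻¹) = (1 + τ N)⁻²`. -/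
lemma integral_segInv_mul_segInv {N : 𝔸} (hN : SegUnit N) :
    ∫ τ in (0 : ℝ)..1, segInv N τ * segInv N τ = segInv N 1 := by
  have h := intervalIntegral.integral_eq_sub_of_hasDerivAt (a := (0 : ℝ)) (b := 1)
    (f := fun τ : ℝ => (τ : ℂ) • segInv N τ) (f' := fun τ => segInv N τ * segInv N τ) ?_ ?_
  · simpa using h
  · intro τ hτ
    rw [uIcc_of_le zero_le_one] at hτ
    have h1 := (Complex.ofRealCLM.hasDerivAt (x := τ)).smul (hasDerivAt_segInv hN hτ)
    refine h1.congr_deriv ?_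
    have h2 := mul_segInv hN hτ
    simp only [Complex.ofRealCLM_apply, Complex.ofReal_one, one_smul, smul_neg]
    calc -((τ : ℂ) • (segInv N τ * N * segInv N τ)) + segInv N τ
        = segInv N τ * ((1 + (τ : ℂ) • N) * segInv N τ)
          - (τ : ℂ) • (segInv N τ * N * segInv N τ) := by rw [h2, mul_one]; abel
      _ = _ := by
          simp only [mul_add, add_mul, one_mul, mul_smul_comm, smul_mul_assoc, mul_assoc]
          abel
  · refine ContinuousOn.intervalIntegrable ?_
    rw [uIcc_of_le zero_le_one]
    exact (continuousOn_segInv hN).mul (continuousOn_segInv hN)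

/-- The logarithmic derivative: `∂ Log (1 + N) = N' (1 + N)⁻¹` at a point where `N` and `N'`
commute. -/
lemma hasDerivWithinAt_segLog {I : Set ℝ} {t : ℝ} {N : ℝ → 𝔸} {N' : 𝔸}
    (hd : HasDerivWithinAt N N' I t) (hN : SegUnit (N t)) (hcomm : Commute N' (N t)) :
    HasDerivWithinAt (fun r => segLog (N r)) (N' * segInv (N t) 1) I t := by
  have h01 : uIcc (0 : ℝ) 1 = Icc 0 1 := uIcc_of_le zero_le_one
  have h := hasDerivWithinAt_integral_segInv hd hN (p := 0) (q := 1) (c := id) (m := fun _ => 1)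
    continuousOn_id (by rw [h01]; exact mapsTo_id _) continuousOn_const
  simp only [mul_one, id] at h
  have hval : ∫ τ in (0 : ℝ)..1, segInv (N t) τ * N' * segInv (N t) τ = N' * segInv (N t) 1 := by
    rw [← integral_segInv_mul_segInv hN, ← intervalIntegral_mul_left]
    swap
    · refine ContinuousOn.intervalIntegrable ?_
      rw [h01]
      exact (continuousOn_segInv hN).mul (continuousOn_segInv hN)
    refine intervalIntegral.integral_congr fun τ _ => ?_
    rw [← (commute_segInv hcomm τ).eq, mul_assoc]
  rw [hval] at h
  obtain ⟨C, hC⟩ := hN.eventually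
  have hev := hd.continuousWithinAt.tendsto.eventually hC
  have hsub : ∀ {r}, SegUnit (N r) → segLog (N r) - segLog (N t) =
      ∫ τ in (0 : ℝ)..1, segInv (N r) τ * (N r - N t) * segInv (N t) τ := by
    intro r hr
    rw [segLog, segLog, ← intervalIntegral.integral_sub (intervalIntegrable_mul_segInv hr _)
      (intervalIntegrable_mul_segInv hN _)]
    refine intervalIntegral.integral_congr fun τ hτ => ?_
    rw [h01] at hτ
    exact mul_segInv_sub hτ hN hr
  have h2 := h.const_add (segLog (N t))
  refine h2.congr_of_eventuallyEq ?_ ?_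
  · filter_upwards [hev] with r hr
    rw [← hsub hr.1]; abel
  · simp

lemma commute_segLog {B N : 𝔸} (h : Commute B N) (hN : SegUnit N) : Commute B (segLog N) := by
  have h1 : B * segLog N = ∫ τ in (0 : ℝ)..1, B * (N * segInv N τ) := by
    rw [segLog, intervalIntegral_mul_left (intervalIntegrable_mul_segInv hN N)]
  have h2 : segLog N * B = ∫ τ in (0 : ℝ)..1, N * segInv N τ * B := by
    rw [segLog, intervalIntegral_mul_right (intervalIntegrable_mul_segInv hN N)]
  rw [Commute, SemiconjBy, h1, h2]
  refine intervalIntegral.integral_congr fun τ _ => ?_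
  exact h.mul_right (commute_segInv h τ)

/-- `exp (-Log (1 + N)) = (1 + N)⁻¹`. -/
lemma exp_neg_segLog {N : 𝔸} (hN : SegUnit N) :
    NormedSpace.exp (-segLog N) = segInv N 1 := by
  let _ : NormedAlgebra ℚ 𝔸 := NormedAlgebra.restrictScalars ℚ ℂ 𝔸
  -- `exp (-Log (1 + σ N)) (1 + σ N)` does not depend on `σ`
  have key : ∀ σ ∈ Icc (0 : ℝ) 1,
      NormedSpace.exp (-segLog ((σ : ℂ) • N)) * (1 + (σ : ℂ) • N) =
      NormedSpace.exp (-segLog (((0 : ℝ) : ℂ) • N)) * (1 + ((0 : ℝ) : ℂ) • N) := by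
    have hder : ∀ σ ∈ Icc (0 : ℝ) 1, HasDerivWithinAt (fun σ : ℝ =>
        NormedSpace.exp (-segLog ((σ : ℂ) • N)) * (1 + (σ : ℂ) • N)) 0 (Icc 0 1) σ := by
      intro σ hσ
      have h1 : HasDerivWithinAt (fun σ : ℝ => (σ : ℂ) • N) N (Icc 0 1) σ := by
        simpa using ((Complex.ofRealCLM.hasDerivAt (x := σ)).smul_const N).hasDerivWithinAt
      have hcs : ∀ σ : ℝ, Commute N ((σ : ℂ) • N) := fun σ => (Commute.refl N).smul_right _
      have h2 := hasDerivWithinAt_segLog h1 (hN.smul hσ) (hcs σ)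
      -- the values of the logarithm commute, so that only the derivative of `exp` at `0` is needed
      have h3 : HasDerivWithinAt (fun σ' : ℝ => segLog ((σ : ℂ) • N) - segLog ((σ' : ℂ) • N))
          (-(N * segInv ((σ : ℂ) • N) 1)) (Icc 0 1) σ := h2.const_sub _
      have h4 : HasFDerivAt NormedSpace.exp (1 : 𝔸 →L[ℝ] 𝔸)
          (segLog ((σ : ℂ) • N) - segLog ((σ : ℂ) • N)) := by
        rw [sub_self]; exact hasFDerivAt_exp_zero
      have h5 := (h4.comp_hasDerivWithinAt σ h3).const_mul (NormedSpace.exp (-segLog ((σ : ℂ) • N)))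
      have h6 := h5.mul (h1.const_add (1 : 𝔸))
      have h7 : HasDerivWithinAt (fun σ : ℝ =>
        NormedSpace.exp (-segLog ((σ : ℂ) • N)) * (1 + (σ : ℂ) • N))
          (NormedSpace.exp (-segLog ((σ : ℂ) • N)) *
            (1 : 𝔸 →L[ℝ] 𝔸) (-(N * segInv ((σ : ℂ) • N) 1)) * (1 + (σ : ℂ) • N) +
          NormedSpace.exp (-segLog ((σ : ℂ) • N)) *
            NormedSpace.exp (segLog ((σ : ℂ) • N) - segLog ((σ : ℂ) • N)) * N) (Icc 0 1) σ := by
        refine h6.congr_of_mem (fun σ' hσ' => ?_) hσ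
        have hc : Commute (segLog ((σ : ℂ) • N)) (segLog ((σ' : ℂ) • N)) := by
          refine commute_segLog ?_ (hN.smul hσ')
          exact ((commute_segLog ((Commute.refl N).smul_right _) (hN.smul hσ)).symm).smul_right _
        simp only [Pi.mul_apply, Function.comp]
        rw [← NormedSpace.exp_add_of_commute]
        · congr 2; abel
        · exact ((Commute.refl _).sub_right hc).neg_left
      refine h7.congr_deriv ?_
      have h8 : segInv ((σ : ℂ) • N) 1 * (1 + (σ : ℂ) • N) = 1 := by
        simpa using segInv_mul (hN.smul hσ) (τ := 1) ⟨zero_le_one, le_rfl⟩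
      simp only [sub_self, NormedSpace.exp_zero, mul_one, one_apply_eq_self, mul_neg,
        neg_mul, mul_assoc, h8]
      abel
    intro σ hσ
    refine constant_of_derivWithin_zero (fun σ hσ => (hder σ hσ).differentiableWithinAt)
      (fun σ hσ => ?_) σ hσ
    exact (hder σ (Ico_subset_Icc_self hσ)).derivWithin
      (uniqueDiffOn_Icc zero_lt_one σ (Ico_subset_Icc_self hσ))
  have h := key 1 ⟨zero_le_one, le_rfl⟩
  have h0 : segLog (0 : 𝔸) = 0 := by simp [segLog]
  simp only [Complex.ofReal_one, one_smul, Complex.ofReal_zero, zero_smul, h0, neg_zero,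
    NormedSpace.exp_zero, add_zero, mul_one] at h
  have h1 := mul_segInv hN (τ := 1) ⟨zero_le_one, le_rfl⟩
  simp only [Complex.ofReal_one, one_smul] at h1
  calc NormedSpace.exp (-segLog N) = NormedSpace.exp (-segLog N) * ((1 + N) * segInv N 1) := by
        rw [h1, mul_one]
    _ = segInv N 1 := by rw [← mul_assoc, h, one_mul]

/-! ### The square root as an integral along a segment -/

/-- The inverse square root `(1 + N)^(-1/2)`, written as
`(2/π) ∫₀^{π/2} (1 + cos²φ N)⁻¹ dφ`. -/
noncomputable def segInvSqrt (N : 𝔸) : 𝔸 :=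
  ((2 / Real.pi : ℝ) : ℂ) • ∫ φ in (0 : ℝ)..(Real.pi / 2), segInv N (Real.cos φ ^ 2)

lemma cos_sq_mem_Icc (φ : ℝ) : Real.cos φ ^ 2 ∈ Icc (0 : ℝ) 1 :=
  ⟨sq_nonneg _, Real.cos_sq_le_one φ⟩

lemma continuous_segInv_cos_sq {N : 𝔸} (hN : SegUnit N) :
    Continuous (fun φ : ℝ => segInv N (Real.cos φ ^ 2)) :=
  (continuousOn_segInv hN).comp_continuous (by fun_prop) cos_sq_mem_Icc

lemma commute_segInvSqrt {B N : 𝔸} (h : Commute B N) (hN : SegUnit N) :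
    Commute B (segInvSqrt N) := by
  have hi : IntervalIntegrable (fun φ : ℝ => segInv N (Real.cos φ ^ 2)) volume 0 (Real.pi / 2) :=
    (continuous_segInv_cos_sq hN).intervalIntegrable _ _
  refine Commute.smul_right ?_ _
  rw [Commute, SemiconjBy, ← intervalIntegral_mul_left hi, ← intervalIntegral_mul_right hi]
  exact intervalIntegral.integral_congr fun φ _ => commute_segInv h _

/-- An integration by parts: the difference of the two sides is the integral of the derivative of
`-sin φ cos φ (1 + cos²φ N)⁻¹`, which vanishes at both end points. -/
lemma integral_segInv_cos_sq {N : 𝔸} (hN : SegUnit N) :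
    (∫ φ in (0 : ℝ)..(Real.pi / 2), segInv N (Real.cos φ ^ 2)) =
      (2 : ℂ) • ((∫ φ in (0 : ℝ)..(Real.pi / 2), ((Real.cos φ ^ 2 : ℝ) : ℂ) •
        (segInv N (Real.cos φ ^ 2) * segInv N (Real.cos φ ^ 2))) * (1 + N)) := by
  have hcont := continuous_segInv_cos_sq hN
  have hi : IntervalIntegrable (fun φ => ((Real.cos φ ^ 2 : ℝ) : ℂ) •
      (segInv N (Real.cos φ ^ 2) * segInv N (Real.cos φ ^ 2))) volume 0 (Real.pi / 2) :=
    Continuous.intervalIntegrable (by fun_prop) _ _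
  rw [← sub_eq_zero, ← intervalIntegral_mul_right hi, ← intervalIntegral.integral_smul,
    ← intervalIntegral.integral_sub (hcont.intervalIntegrable _ _)
      (Continuous.intervalIntegrable (by fun_prop) _ _)]
  have h := intervalIntegral.integral_eq_sub_of_hasDerivAt (a := 0) (b := Real.pi / 2)
    (f := fun φ : ℝ => -(((Real.sin φ * Real.cos φ : ℝ) : ℂ) • segInv N (Real.cos φ ^ 2)))
    (f' := fun φ => segInv N (Real.cos φ ^ 2) - (2 : ℂ) • (((Real.cos φ ^ 2 : ℝ) : ℂ) •
        (segInv N (Real.cos φ ^ 2) * segInv N (Real.cos φ ^ 2)) * (1 + N))) ?_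
        (Continuous.intervalIntegrable (by fun_prop) _ _)
  · rw [h]; simp
  · intro φ _
    have h1 : HasDerivAt (fun φ => Real.cos φ ^ 2) (2 * Real.cos φ * -Real.sin φ) φ := by
      simpa using (Real.hasDerivAt_cos φ).fun_pow 2
    have h2 : HasDerivAt (fun φ => segInv N (Real.cos φ ^ 2))
        ((2 * Real.cos φ * -Real.sin φ) • -(segInv N (Real.cos φ ^ 2) * N *
          segInv N (Real.cos φ ^ 2))) φ :=
      HasDerivAt.scomp (h := fun φ => Real.cos φ ^ 2) φ
        (hasDerivAt_segInv hN (cos_sq_mem_Icc φ)) h1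
    have h3 : HasDerivAt (fun φ => ((Real.sin φ * Real.cos φ : ℝ) : ℂ))
        ((Real.cos φ * Real.cos φ + Real.sin φ * -Real.sin φ : ℝ) : ℂ) φ :=
      ((Real.hasDerivAt_sin φ).mul (Real.hasDerivAt_cos φ)).ofReal_comp
    refine (h3.smul h2).neg.congr_deriv ?_
    have h4 := mul_segInv hN (cos_sq_mem_Icc φ)
    have hc : N * segInv N (Real.cos φ ^ 2) = segInv N (Real.cos φ ^ 2) * N :=
      commute_segInv (Commute.refl N) _
    set J := segInv N (Real.cos φ ^ 2)
    have hs : ((Real.sin φ : ℝ) : ℂ) ^ 2 = 1 - ((Real.cos φ : ℝ) : ℂ) ^ 2 := by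
      have := Real.sin_sq φ
      exact_mod_cast this
    -- everything is expressed through `J²` and `J² N`
    have hJ : J = J * J + ((Real.cos φ : ℝ) : ℂ) ^ 2 • (J * J * N) := by
      have : J * ((1 + ((Real.cos φ ^ 2 : ℝ) : ℂ) • N) * J) = J := by rw [h4, mul_one]
      rw [add_mul, one_mul, smul_mul_assoc, hc, mul_add, mul_smul_comm, ← mul_assoc] at this
      rw [Complex.ofReal_pow] at this
      exact this.symm
    have hJN : J * N * J = J * J * N := by rw [mul_assoc, hc, ← mul_assoc]
    rw [hJN, ← Complex.coe_smul, smul_mul_assoc, mul_add, mul_one]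
    clear_value J
    clear h4 hc hJN
    generalize J * J * N = b at *
    generalize J * J = a at *
    subst hJ
    push_cast at hs ⊢
    match_scalars
    · linear_combination (-Complex.cos φ ^ 2) * hs
    · linear_combination hs

/-- `(1 + N)^(-1/2)` squares to `(1 + N)⁻¹`. -/
lemma segInvSqrt_mul_self {N : 𝔸} (hN : SegUnit N) :
    segInvSqrt N * segInvSqrt N * (1 + N) = 1 := by
  -- `K(σ)² (1 + σ N)` with `K(σ) = (1 + σ N)^(-1/2)` does not depend on `σ`
  have hder : ∀ σ ∈ Icc (0 : ℝ) 1, HasDerivWithinAt (fun σ : ℝ =>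
      segInvSqrt ((σ : ℂ) • N) * segInvSqrt ((σ : ℂ) • N) * (1 + (σ : ℂ) • N)) 0 (Icc 0 1) σ := by
    intro σ hσ
    have hNσ := hN.smul hσ
    have h1 : HasDerivWithinAt (fun σ : ℝ => (σ : ℂ) • N) N (Icc 0 1) σ := by
      simpa using ((Complex.ofRealCLM.hasDerivAt (x := σ)).smul_const N).hasDerivWithinAt
    have h2 := hasDerivWithinAt_integral_segInv h1 hNσ (p := 0) (q := Real.pi / 2)
      (c := fun φ => Real.cos φ ^ 2) (m := fun φ => -(((Real.cos φ ^ 2 : ℝ) : ℂ) • (1 : 𝔸)))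
      (by fun_prop) (fun φ _ => cos_sq_mem_Icc φ) (by fun_prop)
    set D := ∫ φ in (0 : ℝ)..(Real.pi / 2), ((Real.cos φ ^ 2 : ℝ) : ℂ) •
        (segInv ((σ : ℂ) • N) (Real.cos φ ^ 2) * segInv ((σ : ℂ) • N) (Real.cos φ ^ 2)) with hD
    have hcont := continuous_segInv_cos_sq hNσ
    have hiD : IntervalIntegrable (fun φ => ((Real.cos φ ^ 2 : ℝ) : ℂ) •
        (segInv ((σ : ℂ) • N) (Real.cos φ ^ 2) * segInv ((σ : ℂ) • N) (Real.cos φ ^ 2)))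
        volume 0 (Real.pi / 2) :=
      Continuous.intervalIntegrable (by fun_prop) _ _
    have hcN : ∀ τ, N * segInv ((σ : ℂ) • N) τ = segInv ((σ : ℂ) • N) τ * N :=
      fun τ => commute_segInv ((Commute.refl N).smul_right _) τ
    have hval : (∫ φ in (0 : ℝ)..(Real.pi / 2), segInv ((σ : ℂ) • N) (Real.cos φ ^ 2) * N *
        segInv ((σ : ℂ) • N) (Real.cos φ ^ 2) * -(((Real.cos φ ^ 2 : ℝ) : ℂ) • (1 : 𝔸)))
        = -(N * D) := by
      rw [hD, ← intervalIntegral_mul_left hiD, ← intervalIntegral.integral_neg]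
      refine intervalIntegral.integral_congr fun φ _ => ?_
      simp only [mul_neg, mul_smul_comm, mul_one, ← mul_assoc, hcN]
    rw [hval] at h2
    have h3 : HasDerivWithinAt (fun σ : ℝ => segInvSqrt ((σ : ℂ) • N))
        (((2 / Real.pi : ℝ) : ℂ) • -(N * D)) (Icc 0 1) σ := by
      refine ((h2.const_add (∫ φ in (0 : ℝ)..(Real.pi / 2),
        segInv ((σ : ℂ) • N) (Real.cos φ ^ 2))).const_smul
          ((2 / Real.pi : ℝ) : ℂ)).congr_of_mem (fun σ' hσ' => ?_) hσ
      have hNσ' := hN.smul hσ'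
      simp only [Pi.smul_apply, segInvSqrt]
      congr 1
      rw [← sub_eq_iff_eq_add', ← intervalIntegral.integral_sub
        ((continuous_segInv_cos_sq hNσ').intervalIntegrable _ _)
        (hcont.intervalIntegrable _ _)]
      refine intervalIntegral.integral_congr fun φ _ => ?_
      simp only [segInv_sub_segInv (cos_sq_mem_Icc φ) hNσ hNσ', mul_neg, mul_smul_comm, mul_one]
    have h4 := (h3.mul h3).mul (h1.const_add (1 : 𝔸))
    refine h4.congr_deriv ?_
    have hK : segInvSqrt ((σ : ℂ) • N) = (2 : ℂ) • (((2 / Real.pi : ℝ) : ℂ) • D) *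
        (1 + (σ : ℂ) • N) := by
      rw [segInvSqrt, integral_segInv_cos_sq hNσ, smul_comm, smul_mul_assoc, smul_mul_assoc]
    have hcK : N * segInvSqrt ((σ : ℂ) • N) = segInvSqrt ((σ : ℂ) • N) * N :=
      commute_segInvSqrt ((Commute.refl N).smul_right _) hNσ
    have hcD : N * D = D * N := by
      rw [hD, ← intervalIntegral_mul_left hiD, ← intervalIntegral_mul_right hiD]
      refine intervalIntegral.integral_congr fun φ _ => ?_
      simp only [mul_smul_comm, smul_mul_assoc, mul_assoc]
      rw [← mul_assoc, hcN, mul_assoc, hcN]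
    have hcDK : D * segInvSqrt ((σ : ℂ) • N) = segInvSqrt ((σ : ℂ) • N) * D := by
      have hD' : Commute D ((σ : ℂ) • N) := (show Commute D N from hcD.symm).smul_right _
      exact commute_segInvSqrt hD' hNσ
    simp only [Pi.mul_apply]
    set K := segInvSqrt ((σ : ℂ) • N)
    have h5 : N * D * K = K * (N * D) := by rw [mul_assoc, hcDK, ← mul_assoc, hcK, mul_assoc]
    have h6 : K * K * N =
        (2 : ℂ) • (((2 / Real.pi : ℝ) : ℂ) • (K * (N * D) * (1 + (σ : ℂ) • N))) := by
      calc K * K * N = K * N * K := by rw [mul_assoc, mul_assoc, hcK]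
        _ = K * N * ((2 : ℂ) • (((2 / Real.pi : ℝ) : ℂ) • D) * (1 + (σ : ℂ) • N)) := by rw [← hK]
        _ = _ := by simp only [mul_smul_comm, smul_mul_assoc, mul_assoc]
    rw [smul_mul_assoc, neg_mul, h5, mul_smul_comm, mul_neg, h6, ← two_smul ℂ, smul_mul_assoc,
      smul_mul_assoc, neg_mul]
    module
  have hconst := constant_of_derivWithin_zero (fun σ hσ => (hder σ hσ).differentiableWithinAt)
    (fun σ hσ => (hder σ (Ico_subset_Icc_self hσ)).derivWithin
      (uniqueDiffOn_Icc zero_lt_one σ (Ico_subset_Icc_self hσ))) 1 ⟨zero_le_one, le_rfl⟩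
  have h0 : segInvSqrt (0 : 𝔸) = 1 := by
    have hpi : (Real.pi : ℂ) ≠ 0 := by exact_mod_cast Real.pi_ne_zero
    simp only [segInvSqrt, segInv, smul_zero, add_zero, Ring.inverse_one,
      intervalIntegral.integral_const, sub_zero, ← Complex.coe_smul, smul_smul]
    rw [show ((2 / Real.pi : ℝ) : ℂ) * ((Real.pi / 2 : ℝ) : ℂ) = 1 by push_cast; field_simp,
      one_smul]
  simpa [h0] using hconst

end BanachAlgebra

/-! ### Contour integrals over rectangles -/

section Rectangle

lemma continuousOn_horizontal {E : Type*} [TopologicalSpace E] {g : ℂ → E} {O : Set ℂ} {a b c : ℝ}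
    (hg : ContinuousOn g O)
    (h : ∀ x ∈ uIcc a b, (x + c * Complex.I : ℂ) ∈ O) :
    ContinuousOn (fun x : ℝ => g (x + c * Complex.I)) (uIcc a b) :=
  hg.comp (by fun_prop) h

lemma continuousOn_vertical {E : Type*} [TopologicalSpace E] {g : ℂ → E} {O : Set ℂ} {a c d : ℝ}
    (hg : ContinuousOn g O)
    (h : ∀ y ∈ uIcc c d, (a + y * Complex.I : ℂ) ∈ O) :
    ContinuousOn (fun y : ℝ => g (a + y * Complex.I)) (uIcc c d) :=
  hg.comp (by fun_prop) h

variable {E : Type*} [NormedAddCommGroup E] [NormedSpace ℂ E]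

/-- The contour integral of `g` over the positively oriented boundary of `[a, b] × [c, d]`. -/
noncomputable def rectInt (g : ℂ → E) (a b c d : ℝ) : E :=
  (∫ x in a..b, g (x + c * Complex.I)) - (∫ x in a..b, g (x + d * Complex.I)) +
    Complex.I • (∫ y in c..d, g (b + y * Complex.I)) -
    Complex.I • (∫ y in c..d, g (a + y * Complex.I))

lemma rectInt_swap_horizontal (g : ℂ → E) (a b c d : ℝ) :
    rectInt g b a c d = -rectInt g a b c d := by
  simp only [rectInt, intervalIntegral.integral_symm a b]
  abel

lemma rectInt_swap_vertical (g : ℂ → E) (a b c d : ℝ) :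
    rectInt g a b d c = -rectInt g a b c d := by
  simp only [rectInt, intervalIntegral.integral_symm c d, smul_neg]
  abel

variable {g : ℂ → E} {O : Set ℂ} {a b c d : ℝ}

lemma rectInt_eq_zero [CompleteSpace E] (hg : DifferentiableOn ℂ g (uIcc a b ×ℂ uIcc c d)) :
    rectInt g a b c d = 0 :=
  Complex.integral_boundary_rect_eq_zero_of_differentiableOn g ⟨a, c⟩ ⟨b, d⟩ hg

/-- Cauchy's theorem: the horizontal side at height `d` may be moved to height `d'`. -/
lemma rectInt_move_horizontal [CompleteSpace E] {d' : ℝ} (hg : DifferentiableOn ℂ g O)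
    (ha : ∀ y ∈ uIcc c d, (a + y * Complex.I : ℂ) ∈ O)
    (hb : ∀ y ∈ uIcc c d, (b + y * Complex.I : ℂ) ∈ O)
    (hO : uIcc a b ×ℂ uIcc d d' ⊆ O) : rectInt g a b c d' = rectInt g a b c d := by
  have h0 := rectInt_eq_zero (hg.mono hO)
  have ia := (continuousOn_vertical hg.continuousOn ha).intervalIntegrable (μ := volume)
  have ib := (continuousOn_vertical hg.continuousOn hb).intervalIntegrable (μ := volume)
  have ia' := (continuousOn_vertical (c := d) (d := d') (a := a) hg.continuousOn
    (fun y hy => hO (by simp [Complex.mem_reProdIm, hy]))).intervalIntegrable (μ := volume)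
  have ib' := (continuousOn_vertical (c := d) (d := d') (a := b) hg.continuousOn
    (fun y hy => hO (by simp [Complex.mem_reProdIm, hy]))).intervalIntegrable (μ := volume)
  rw [← add_zero (rectInt g a b c d), ← h0]
  simp only [rectInt, ← intervalIntegral.integral_add_adjacent_intervals ia ia',
    ← intervalIntegral.integral_add_adjacent_intervals ib ib', smul_add]
  abel

/-- Cauchy's theorem: the vertical side at abscissa `b` may be moved to abscissa `b'`. -/
lemma rectInt_move_vertical [CompleteSpace E] {b' : ℝ} (hg : DifferentiableOn ℂ g O)
    (hc : ∀ x ∈ uIcc a b, (x + c * Complex.I : ℂ) ∈ O)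
    (hd : ∀ x ∈ uIcc a b, (x + d * Complex.I : ℂ) ∈ O)
    (hO : uIcc b b' ×ℂ uIcc c d ⊆ O) : rectInt g a b' c d = rectInt g a b c d := by
  have h0 := rectInt_eq_zero (hg.mono hO)
  have ic := (continuousOn_horizontal hg.continuousOn hc).intervalIntegrable (μ := volume)
  have id := (continuousOn_horizontal hg.continuousOn hd).intervalIntegrable (μ := volume)
  have ic' := (continuousOn_horizontal (c := c) (a := b) (b := b') hg.continuousOn
    (fun y hy => hO (by simp [Complex.mem_reProdIm, hy]))).intervalIntegrable (μ := volume)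
  have id' := (continuousOn_horizontal (c := d) (a := b) (b := b') hg.continuousOn
    (fun y hy => hO (by simp [Complex.mem_reProdIm, hy]))).intervalIntegrable (μ := volume)
  rw [← add_zero (rectInt g a b c d), ← h0]
  simp only [rectInt, ← intervalIntegral.integral_add_adjacent_intervals ic ic',
    ← intervalIntegral.integral_add_adjacent_intervals id id']
  abel

end Rectangle

/-! ### The Riesz-Dunford logarithm -/

section Log

variable {𝔸 : Type*} [NormedRing 𝔸] [NormedAlgebra ℂ 𝔸]

lemma eq_of_exp_eq_exp {v w : ℂ} (hv : |v.im| < Real.pi) (hw : |w.im| ≤ Real.pi)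
    (h : Complex.exp v = Complex.exp w) : v = w := by
  obtain ⟨n, hn⟩ := Complex.exp_eq_exp_iff_exists_int.1 h
  have him : v.im = w.im + n * (2 * Real.pi) := by
    have := congrArg Complex.im hn
    simpa using this
  have hn0 : n = 0 := by
    have hpi := Real.pi_pos
    rw [abs_lt] at hv
    rw [abs_le] at hw
    have h1 : (n : ℝ) < 1 := by
      by_contra! hc
      nlinarith
    have h2 : (-1 : ℝ) < n := by
      by_contra! hc
      nlinarith
    have h3 : n < 1 := by exact_mod_cast h1
    have h4 : -1 < n := by exact_mod_cast h2
    omega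
  simpa [hn0] using hn

/-- The points of the closed strip `|Im w| ≤ π` outside the rectangle of an annular sector that
contains the spectrum are mapped to the resolvent set. -/
lemma exp_mem_resolventSet {M : 𝔸} {a b θ : ℝ} (hθ : θ < Real.pi)
    (hσ : spectrum ℂ M ⊆ annularSector a b θ) {w : ℂ} (hw : |w.im| ≤ Real.pi)
    (hw' : ¬(a < w.re ∧ w.re < b ∧ |w.im| < θ)) : Complex.exp w ∈ resolventSet ℂ M := by
  by_contra hc
  obtain ⟨v, hv, hvw⟩ := hσ hc
  exact hw' (eq_of_exp_eq_exp (hv.2.2.trans hθ) hw hvw ▸ hv)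

lemma annularSector_subset_slitPlane {a b θ : ℝ} (hθ : θ < Real.pi) :
    annularSector a b θ ⊆ Complex.slitPlane := by
  rintro _ ⟨w, hw, rfl⟩
  rw [Complex.mem_slitPlane_iff_arg]
  refine ⟨?_, Complex.exp_ne_zero _⟩
  have h := abs_lt.1 (hw.2.2.trans hθ)
  have := Complex.log_exp h.1 h.2.le
  rw [← Complex.log_im, this]
  exact h.2.ne

/-- If the spectrum of `M` avoids `(-∞, 0]`, the segment from `1` to `M` is invertible. -/
lemma segUnit_of_spectrum {M : 𝔸} (hσ : spectrum ℂ M ⊆ Complex.slitPlane) : SegUnit (M - 1) := by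
  intro τ hτ
  rcases hτ.1.eq_or_lt with rfl | hτ0
  · simp
  have hz : (((1 - τ⁻¹ : ℝ) : ℂ)) ∈ resolventSet ℂ M := by
    by_contra hc
    have := hσ hc
    rw [Complex.ofReal_mem_slitPlane] at this
    have h1 := one_le_inv_iff₀.2 ⟨hτ0, hτ.2⟩
    linarith
  rw [spectrum.mem_resolventSet_iff] at hz
  have hu : IsUnit (-(τ : ℂ)) := by simpa using hτ0.ne'
  have h2 : 1 + (τ : ℂ) • (M - 1) =
      algebraMap ℂ 𝔸 (-(τ : ℂ)) * (algebraMap ℂ 𝔸 ((1 - τ⁻¹ : ℝ) : ℂ) - M) := by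
    have hτc : (τ : ℂ) ≠ 0 := by exact_mod_cast hτ0.ne'
    rw [mul_sub, ← map_mul, ← Algebra.smul_def, Algebra.algebraMap_eq_smul_one]
    rw [show -(τ : ℂ) * ((1 - τ⁻¹ : ℝ) : ℂ) = 1 - τ by push_cast; field_simp; ring]
    module
  rw [h2]
  exact (hu.map _).mul hz

lemma segUnit_algebraMap {z : ℂ} (hz : z ∈ Complex.slitPlane) :
    SegUnit (algebraMap ℂ 𝔸 (z - 1)) := by
  intro τ hτ
  have h1 : 1 + (τ : ℂ) * (z - 1) ∈ Complex.slitPlane := by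
    have := Complex.starConvex_one_slitPlane.add_smul_mem (y := z - 1) (by simpa using hz) hτ.1 hτ.2
    simpa using this
  have h2 : IsUnit (1 + (τ : ℂ) * (z - 1)) := (Complex.slitPlane_ne_zero h1).isUnit
  simpa [Algebra.smul_def] using h2.map (algebraMap ℂ 𝔸)

/-- Passage to the limit in vertical integrals. -/
lemma tendsto_integral_vertical {g : ℂ → 𝔸} {l : Filter ℝ} [l.IsCountablyGenerated] {L : 𝔸}
    (hg : Tendsto g (comap Complex.re l) (𝓝 L)) {c d : ℝ}
    (hc : ∀ᶠ x : ℝ in l, ContinuousOn (fun y : ℝ => g (x + y * Complex.I)) (uIcc c d)) :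
    Tendsto (fun x : ℝ => ∫ y in c..d, g (x + y * Complex.I)) l (𝓝 (∫ _ in c..d, L)) := by
  have hline : ∀ y : ℝ, Tendsto (fun x : ℝ => (x + y * Complex.I : ℂ)) l (comap Complex.re l) := by
    intro y
    rw [tendsto_comap_iff]
    have h : (Complex.re ∘ fun x : ℝ => (x + y * Complex.I : ℂ)) = id := by ext; simp
    rw [h]
    exact tendsto_id
  refine intervalIntegral.tendsto_integral_filter_of_dominated_convergence
    (fun _ => ‖L‖ + 1) ?_ ?_ intervalIntegrable_const ?_
  · filter_upwards [hc] with x hx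
    exact (hx.mono uIoc_subset_uIcc).aestronglyMeasurable measurableSet_uIoc
  · have h1 := hg.norm.eventually (gt_mem_nhds (lt_add_one ‖L‖))
    rw [eventually_comap] at h1
    filter_upwards [h1] with x hx
    exact Eventually.of_forall fun y _ => (hx _ (by simp)).le
  · exact Eventually.of_forall fun y _ => hg.comp (hline y)

variable [CompleteSpace 𝔸]

lemma rectInt_mul_left_add {f g h : ℂ → 𝔸} {O : Set ℂ} {a b c d : ℝ} (B : 𝔸)
    (hf : ContinuousOn f O) (hh : ContinuousOn h O) (hg : ∀ w ∈ O, g w = B * f w + h w)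
    (hc : ∀ x ∈ uIcc a b, (x + c * Complex.I : ℂ) ∈ O)
    (hd : ∀ x ∈ uIcc a b, (x + d * Complex.I : ℂ) ∈ O)
    (ha : ∀ y ∈ uIcc c d, (a + y * Complex.I : ℂ) ∈ O)
    (hb : ∀ y ∈ uIcc c d, (b + y * Complex.I : ℂ) ∈ O) :
    rectInt g a b c d = B * rectInt f a b c d + rectInt h a b c d := by
  have key : ∀ {p q : ℝ} {γ : ℝ → ℂ}, ContinuousOn γ (uIcc p q) → (∀ x ∈ uIcc p q, γ x ∈ O) →
      ∫ x in p..q, g (γ x) = B * (∫ x in p..q, f (γ x)) + ∫ x in p..q, h (γ x) := by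
    intro p q γ hγ hγO
    have hi := (hf.comp hγ hγO).intervalIntegrable (μ := volume)
    have hi' := (hh.comp hγ hγO).intervalIntegrable (μ := volume)
    have hiB : IntervalIntegrable (fun x => B * f (γ x)) volume p q :=
      (continuousOn_const.mul (hf.comp hγ hγO)).intervalIntegrable
    simp only [Function.comp_def] at hi hi'
    rw [← intervalIntegral_mul_left hi, ← intervalIntegral.integral_add hiB hi']
    exact intervalIntegral.integral_congr fun x hx => hg _ (hγO x hx)
  simp only [rectInt]
  rw [key (by fun_prop) hc, key (by fun_prop) hd, key (by fun_prop) ha, key (by fun_prop) hb]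
  simp only [mul_add, mul_sub, smul_add, mul_smul_comm]
  abel

lemma segLog_algebraMap {z : ℂ} (hz : z ∈ Complex.slitPlane) :
    segLog (algebraMap ℂ 𝔸 (z - 1)) = algebraMap ℂ 𝔸 (Complex.log z) := by
  have h1 := Complex.log_eq_integral (z := z - 1) (by simpa using hz)
  rw [add_sub_cancel] at h1
  have hne : ∀ τ ∈ uIcc (0 : ℝ) 1, 1 + τ • (z - 1) ≠ 0 := by
    intro τ hτ
    rw [uIcc_of_le zero_le_one] at hτ
    exact Complex.slitPlane_ne_zero
      (Complex.starConvex_one_slitPlane.add_smul_mem (y := z - 1) (by simpa using hz) hτ.1 hτ.2)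
  have hi : IntervalIntegrable (fun τ : ℝ => (1 + τ • (z - 1))⁻¹) volume 0 1 :=
    ContinuousOn.intervalIntegrable (ContinuousOn.inv₀ (by fun_prop) hne)
  have h2 : ∀ τ ∈ uIcc (0 : ℝ) 1, segInv (algebraMap ℂ 𝔸 (z - 1)) τ =
      algebraMap ℂ 𝔸 ((1 + τ • (z - 1))⁻¹) := by
    intro τ hτ
    have h3 : 1 + (τ : ℂ) • algebraMap ℂ 𝔸 (z - 1) = algebraMap ℂ 𝔸 (1 + τ • (z - 1)) := by
      simp [Algebra.smul_def]
    have h4 : algebraMap ℂ 𝔸 ((1 + τ • (z - 1))⁻¹) * algebraMap ℂ 𝔸 (1 + τ • (z - 1)) = 1 := by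
      rw [← map_mul, inv_mul_cancel₀ (hne τ hτ), map_one]
    have hu := (isUnit_iff_ne_zero.2 (hne τ hτ)).map (algebraMap ℂ 𝔸)
    rw [segInv, h3, ← one_mul (Ring.inverse _), ← h4, Ring.mul_inverse_cancel_right _ _ hu]
  have h5 := (Algebra.linearMap ℂ 𝔸).toContinuousLinearMap.intervalIntegral_comp_comm hi
  rw [h1, map_mul, segLog, intervalIntegral_mul_left]
  · congr 1
    exact (intervalIntegral.integral_congr h2).trans h5
  · have := intervalIntegrable_mul_segInv (segUnit_algebraMap (𝔸 := 𝔸) hz) 1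
    simpa using this

/-- The integral `∫₀¹ (1 + τ (z - 1))⁻¹ (1 + τ (M - 1))⁻¹ dτ`, which is the difference quotient
`(Log z - Log M) (z - M)⁻¹`. -/
noncomputable def logQuotient (M : 𝔸) (z : ℂ) : 𝔸 :=
  ∫ τ in (0 : ℝ)..1, segInv (algebraMap ℂ 𝔸 (z - 1)) τ * segInv (M - 1) τ

lemma continuousOn_logQuotient {M : 𝔸} (hM : SegUnit (M - 1)) {z : ℂ}
    (hz : z ∈ Complex.slitPlane) : ContinuousOn
      (fun τ => segInv (algebraMap ℂ 𝔸 (z - 1)) τ * segInv (M - 1) τ) (uIcc 0 1) := by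
  rw [uIcc_of_le zero_le_one]
  exact (continuousOn_segInv (segUnit_algebraMap hz)).mul (continuousOn_segInv hM)

lemma differentiableAt_logQuotient {M : 𝔸} (hM : SegUnit (M - 1)) {z : ℂ}
    (hz : z ∈ Complex.slitPlane) : DifferentiableAt ℂ (logQuotient M) z := by
  have h01 : uIcc (0 : ℝ) 1 = Icc 0 1 := uIcc_of_le zero_le_one
  have h1 : HasDerivWithinAt (fun z : ℂ => algebraMap ℂ 𝔸 (z - 1)) 1 univ z := by
    simp only [Algebra.algebraMap_eq_smul_one]
    rw [hasDerivWithinAt_univ]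
    simpa using ((hasDerivAt_id' z).sub_const 1).smul_const (1 : 𝔸)
  have h2 := hasDerivWithinAt_integral_segInv h1 (segUnit_algebraMap hz) (p := 0) (q := 1) (c := id)
    (m := fun τ => -((τ : ℂ) • segInv (M - 1) τ)) continuousOn_id
    (by rw [h01]; exact mapsTo_id _)
    (by rw [h01]; exact (ContinuousOn.smul (by fun_prop) (continuousOn_segInv hM)).neg)
  rw [hasDerivWithinAt_univ] at h2
  have h3 := h2.differentiableAt.const_add (logQuotient M z)
  refine h3.congr_of_eventuallyEq ?_
  filter_upwards [Complex.isOpen_slitPlane.mem_nhds hz] with z' hz'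
  rw [← sub_eq_iff_eq_add', logQuotient, logQuotient, ← intervalIntegral.integral_sub
    (continuousOn_logQuotient hM hz').intervalIntegrable
    (continuousOn_logQuotient hM hz).intervalIntegrable]
  refine intervalIntegral.integral_congr fun τ hτ => ?_
  rw [h01] at hτ
  simp only [id, ← sub_mul, segInv_sub_segInv hτ (segUnit_algebraMap hz) (segUnit_algebraMap hz'),
    neg_mul, mul_neg, smul_mul_assoc, mul_smul_comm]

/-- `Log z - Log M = logQuotient M z (z - M)`. -/
lemma logQuotient_mul {M : 𝔸} (hM : SegUnit (M - 1)) {z : ℂ} (hz : z ∈ Complex.slitPlane) :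
    logQuotient M z * (algebraMap ℂ 𝔸 z - M) =
      algebraMap ℂ 𝔸 (Complex.log z) - segLog (M - 1) := by
  rw [← segLog_algebraMap hz, segLog, segLog, ← intervalIntegral.integral_sub
    (intervalIntegrable_mul_segInv (segUnit_algebraMap hz) _)
    (intervalIntegrable_mul_segInv hM _), logQuotient,
    ← intervalIntegral_mul_right (continuousOn_logQuotient hM hz).intervalIntegrable]
  refine intervalIntegral.integral_congr fun τ hτ => ?_
  rw [uIcc_of_le zero_le_one] at hτ
  rw [mul_segInv_sub hτ hM (segUnit_algebraMap hz), mul_assoc, mul_assoc]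
  congr 1
  have hc : Commute (algebraMap ℂ 𝔸 z - M) (segInv (M - 1) τ) := by
    refine commute_segInv ?_ τ
    exact (Algebra.commute_algebraMap_left z _).sub_left
      ((Commute.refl M).sub_right (Commute.one_right M))
  rw [← hc.eq, map_sub, map_one, sub_sub_sub_cancel_right]

lemma tendsto_exp_smul_resolvent_atTop (M : 𝔸) :
    Tendsto (fun w => Complex.exp w • resolvent M (Complex.exp w)) (comap Complex.re atTop)
      (𝓝 1) := by
  have h1 : ∀ w, Complex.exp w • resolvent M (Complex.exp w) =
      Ring.inverse (1 - Complex.exp (-w) • M) := by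
    intro w
    have h := spectrum.units_smul_resolvent_self (r := Units.mk0 _ (Complex.exp_ne_zero w)) (a := M)
    simp only [Units.smul_def, Units.val_mk0, Units.val_inv_eq_inv_val] at h
    rw [h, resolvent, map_one, Complex.exp_neg]
  simp only [h1]
  have h2 : Tendsto (fun w => Complex.exp (-w)) (comap Complex.re atTop) (𝓝 0) := by
    rw [tendsto_zero_iff_norm_tendsto_zero]
    simp only [Complex.norm_exp, Complex.neg_re]
    exact Real.tendsto_exp_neg_atTop_nhds_zero.comp tendsto_comap
  have h3 : Tendsto (fun w => 1 - Complex.exp (-w) • M) (comap Complex.re atTop) (𝓝 (1 : 𝔸)) := by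
    simpa using (h2.smul_const M).const_sub 1
  have h4 := NormedRing.inverse_continuousAt (1 : 𝔸ˣ)
  simpa [Function.comp_def] using h4.tendsto.comp h3

lemma tendsto_exp_smul_resolvent_atBot {M : 𝔸} (hM : (0 : ℂ) ∈ resolventSet ℂ M) :
    Tendsto (fun w => Complex.exp w • resolvent M (Complex.exp w)) (comap Complex.re atBot)
      (𝓝 0) := by
  have h2 : Tendsto Complex.exp (comap Complex.re atBot) (𝓝 0) := by
    rw [tendsto_zero_iff_norm_tendsto_zero]
    simp only [Complex.norm_exp]
    exact Real.tendsto_exp_atBot.comp tendsto_comap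
  have h3 := (spectrum.hasDerivAt_resolvent_const_left hM).continuousAt.tendsto.comp h2
  simpa using h2.smul h3

/-- `(2πi)⁻¹ ∮ (z - M)⁻¹ dz = 1`: the contour is widened to the strip `|Im w| ≤ π`, on whose sides
the integrand agrees by periodicity, and the vertical sides are moved to `±∞`. -/
lemma rectInt_exp_smul_resolvent {M : 𝔸} {a b θ : ℝ} (hθ0 : 0 < θ)
    (hθ : θ < Real.pi) (hσ : spectrum ℂ M ⊆ annularSector a b θ) :
    rectInt (fun w => Complex.exp w • resolvent M (Complex.exp w)) a b (-θ) θ =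
      (2 * Real.pi * Complex.I) • (1 : 𝔸) := by
  set f : ℂ → 𝔸 := fun w => Complex.exp w • resolvent M (Complex.exp w) with hf
  set O : Set ℂ := {w | Complex.exp w ∈ resolventSet ℂ M} with hO
  have hfO : DifferentiableOn ℂ f O := by
    intro w hw
    have h1 := ((spectrum.hasDerivAt_resolvent_const_left hw).differentiableAt.comp w
      Complex.differentiableAt_exp)
    exact (Complex.differentiableAt_exp.smul h1).differentiableWithinAt
  have hpi := Real.pi_pos
  have hmem : ∀ {w : ℂ}, |w.im| ≤ Real.pi → ¬(a < w.re ∧ w.re < b ∧ |w.im| < θ) → w ∈ O :=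
    fun h h' => exp_mem_resolventSet hθ hσ h h'
  have hbig : ∀ a' ≤ a, ∀ b' ≥ b, rectInt f a b (-θ) θ = rectInt f a' b' (-Real.pi) Real.pi := by
    intro a' ha' b' hb'
    -- the four sides are moved one at a time, each across a part of the resolvent set
    have s1 : rectInt f a b (-θ) Real.pi = rectInt f a b (-θ) θ := by
      refine rectInt_move_horizontal hfO (fun y hy => ?_) (fun y hy => ?_) (fun w hw => ?_)
      · rw [uIcc_of_le (by linarith), mem_Icc] at hy
        exact hmem (by simpa using abs_le.2 ⟨by linarith, by linarith⟩) (by simp)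
      · rw [uIcc_of_le (by linarith), mem_Icc] at hy
        exact hmem (by simpa using abs_le.2 ⟨by linarith, by linarith⟩) (by simp)
      · rw [Complex.mem_reProdIm, uIcc_of_le hθ.le, mem_Icc] at hw
        refine hmem (abs_le.2 ⟨by linarith, hw.2.2⟩) fun h => ?_
        exact (h.2.2.trans_le (hw.2.1.trans (le_abs_self _))).false
    have s2 : rectInt f a b Real.pi (-Real.pi) = rectInt f a b Real.pi (-θ) := by
      refine rectInt_move_horizontal hfO (fun y hy => ?_) (fun y hy => ?_) (fun w hw => ?_)
      · rw [uIcc_of_ge (by linarith), mem_Icc] at hy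
        exact hmem (by simpa using abs_le.2 ⟨by linarith, by linarith⟩) (by simp)
      · rw [uIcc_of_ge (by linarith), mem_Icc] at hy
        exact hmem (by simpa using abs_le.2 ⟨by linarith, by linarith⟩) (by simp)
      · rw [Complex.mem_reProdIm, uIcc_of_ge (neg_le_neg hθ.le), mem_Icc] at hw
        refine hmem (abs_le.2 ⟨hw.2.1, by linarith⟩) fun h => ?_
        have := (abs_lt.1 h.2.2).1
        linarith [hw.2.2]
    have hside : ∀ (x y : ℝ), |y| = Real.pi → (x + y * Complex.I : ℂ) ∈ O := by
      intro x y hy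
      refine hmem (by simp [hy]) fun h => ?_
      have := h.2.2
      simp [hy] at this
      linarith
    have hpp : |(-Real.pi)| = Real.pi := by rw [abs_neg, abs_of_pos hpi]
    have s3 : rectInt f a b' (-Real.pi) Real.pi = rectInt f a b (-Real.pi) Real.pi := by
      refine rectInt_move_vertical hfO (fun x _ => hside x _ hpp)
        (fun x _ => hside x _ (abs_of_pos hpi)) (fun w hw => ?_)
      rw [Complex.mem_reProdIm, uIcc_of_le hb', uIcc_of_le (by linarith), mem_Icc] at hw
      exact hmem (abs_le.2 hw.2) fun h => (h.2.1.trans_le hw.1.1).false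
    have s4 : rectInt f b' a' (-Real.pi) Real.pi = rectInt f b' a (-Real.pi) Real.pi := by
      refine rectInt_move_vertical hfO (fun x _ => hside x _ hpp)
        (fun x _ => hside x _ (abs_of_pos hpi)) (fun w hw => ?_)
      rw [Complex.mem_reProdIm, uIcc_of_ge ha', uIcc_of_le (by linarith), mem_Icc] at hw
      exact hmem (abs_le.2 hw.2) fun h => (h.1.trans_le hw.1.2).false
    rw [rectInt_swap_vertical f a b (-Real.pi), rectInt_swap_vertical f a b (-θ), neg_inj] at s2
    rw [rectInt_swap_horizontal f a' b', rectInt_swap_horizontal f a b', neg_inj] at s4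
    rw [← s1, ← s2, ← s3, ← s4]
  have hper : ∀ x : ℝ, f (x + ((-Real.pi : ℝ) : ℂ) * Complex.I) = f (x + Real.pi * Complex.I) := by
    intro x
    have : Complex.exp (x + ((-Real.pi : ℝ) : ℂ) * Complex.I) =
        Complex.exp (x + Real.pi * Complex.I) := by
      rw [Complex.exp_eq_exp_iff_exists_int]
      exact ⟨-1, by push_cast; ring⟩
    simp only [hf, this]
  have hZ : ∀ a' ≤ a, ∀ b' ≥ b, rectInt f a b (-θ) θ =
      Complex.I • (∫ y in (-Real.pi)..Real.pi, f (b' + y * Complex.I)) -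
      Complex.I • (∫ y in (-Real.pi)..Real.pi, f (a' + y * Complex.I)) := by
    intro a' ha' b' hb'
    rw [hbig a' ha' b' hb', rectInt]
    simp only [hper, sub_self, zero_add]
  have h0 : (0 : ℂ) ∈ resolventSet ℂ M := by
    by_contra hc
    obtain ⟨v, -, hv⟩ := hσ hc
    exact Complex.exp_ne_zero v hv
  have hcv : ∀ x : ℝ, (x ≤ a ∨ b ≤ x) → ContinuousOn (fun y : ℝ => f (x + y * Complex.I))
      (uIcc (-Real.pi) Real.pi) := by
    intro x hx
    refine continuousOn_vertical hfO.continuousOn fun y hy => ?_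
    rw [uIcc_of_le (by linarith)] at hy
    refine hmem (by simpa using abs_le.2 hy) fun h => ?_
    simp only [Complex.add_re, Complex.ofReal_re, Complex.mul_re, Complex.I_re, mul_zero,
      Complex.ofReal_im, Complex.I_im, mul_one, sub_self, add_zero] at h
    rcases hx with hx | hx
    · exact (h.1.trans_le hx).false
    · exact (h.2.1.trans_le hx).false
  have hT := tendsto_integral_vertical (c := -Real.pi) (d := Real.pi)
    (tendsto_exp_smul_resolvent_atTop M)
    ((eventually_ge_atTop b).mono fun x hx => hcv x (Or.inr hx))
  have hB := tendsto_integral_vertical (c := -Real.pi) (d := Real.pi)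
    (tendsto_exp_smul_resolvent_atBot h0)
    ((eventually_le_atBot a).mono fun x hx => hcv x (Or.inl hx))
  -- `b' → ∞` first, then `a' → -∞`
  have e1 : ∀ a' ≤ a, rectInt f a b (-θ) θ =
      Complex.I • (∫ _ in (-Real.pi)..Real.pi, (1 : 𝔸)) -
      Complex.I • (∫ y in (-Real.pi)..Real.pi, f (a' + y * Complex.I)) := fun a' ha' =>
    tendsto_nhds_unique (tendsto_const_nhds.congr' ((eventually_ge_atTop b).mono (hZ a' ha')))
      ((hT.const_smul Complex.I).sub_const _)
  have e2 := tendsto_nhds_unique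
    (tendsto_const_nhds.congr' ((eventually_le_atBot a).mono e1))
    ((hB.const_smul Complex.I).const_sub (Complex.I • (∫ _ in (-Real.pi)..Real.pi, (1 : 𝔸))))
  rw [e2]
  simp only [intervalIntegral.integral_const, smul_zero, sub_zero, ← Complex.coe_smul, smul_smul]
  congr 1
  push_cast
  ring

/-- The Riesz-Dunford integral of the logarithm does not depend on the contour: it is
`∫₀¹ (M - 1) (1 + τ (M - 1))⁻¹ dτ`. -/
lemma rectInt_log_resolvent {M : 𝔸} {a b θ : ℝ} (hθ0 : 0 < θ)
    (hθ : θ < Real.pi) (hσ : spectrum ℂ M ⊆ annularSector a b θ) :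
    rectInt (fun w => (w * Complex.exp w) • resolvent M (Complex.exp w)) a b (-θ) θ =
      (2 * Real.pi * Complex.I) • segLog (M - 1) := by
  have hM := segUnit_of_spectrum (hσ.trans (annularSector_subset_slitPlane hθ))
  have hslit : ∀ {w : ℂ}, |w.im| < Real.pi → Complex.exp w ∈ Complex.slitPlane := fun {w} hw =>
    annularSector_subset_slitPlane (a := w.re - 1) (b := w.re + 1) (θ := (|w.im| + Real.pi) / 2)
      (by linarith) ⟨w, ⟨by linarith, by linarith, by linarith⟩, rfl⟩
  have hh : ∀ w : ℂ, |w.im| < Real.pi →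
      DifferentiableAt ℂ (fun w => Complex.exp w • logQuotient M (Complex.exp w)) w := fun w hw =>
    Complex.differentiableAt_exp.smul
      ((differentiableAt_logQuotient hM (hslit hw)).comp w Complex.differentiableAt_exp)
  have h0 : rectInt (fun w => Complex.exp w • logQuotient M (Complex.exp w)) a b (-θ) θ = 0 := by
    refine rectInt_eq_zero fun w hw => (hh w ?_).differentiableWithinAt
    rw [Complex.mem_reProdIm, uIcc_of_le (by linarith : -θ ≤ θ)] at hw
    exact (abs_le.2 hw.2).trans_lt hθ
  have hmem : ∀ {w : ℂ}, |w.im| ≤ θ → ¬(a < w.re ∧ w.re < b ∧ |w.im| < θ) →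
      w ∈ {w : ℂ | |w.im| < Real.pi ∧ Complex.exp w ∈ resolventSet ℂ M} := fun h h' =>
    ⟨h.trans_lt hθ, exp_mem_resolventSet hθ hσ (h.trans hθ.le) h'⟩
  have key := rectInt_mul_left_add (a := a) (b := b) (c := -θ) (d := θ)
    (O := {w : ℂ | |w.im| < Real.pi ∧ Complex.exp w ∈ resolventSet ℂ M})
    (f := fun w => Complex.exp w • resolvent M (Complex.exp w))
    (g := fun w => (w * Complex.exp w) • resolvent M (Complex.exp w))
    (h := fun w => Complex.exp w • logQuotient M (Complex.exp w)) (segLog (M - 1))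
    (fun w hw => (Complex.differentiableAt_exp.smul
      ((spectrum.hasDerivAt_resolvent_const_left hw.2).differentiableAt.comp w
        Complex.differentiableAt_exp)).continuousAt.continuousWithinAt)
    (fun w hw => (hh w hw.1).continuousAt.continuousWithinAt) ?_
    (fun x _ => hmem (by simp [abs_of_pos hθ0]) (by simp [abs_of_pos hθ0]))
    (fun x _ => hmem (by simp [abs_of_pos hθ0]) (by simp [abs_of_pos hθ0]))
    (fun y hy => hmem ?_ (by simp)) (fun y hy => hmem ?_ (by simp))
  · rw [key, h0, add_zero, rectInt_exp_smul_resolvent hθ0 hθ hσ, mul_smul_comm, mul_one]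
  · rintro w ⟨hw, hwρ⟩
    have h1 := logQuotient_mul hM (hslit hw)
    rw [Complex.log_exp (abs_lt.1 hw).1 (abs_lt.1 hw).2.le] at h1
    have h2 : (algebraMap ℂ 𝔸 (Complex.exp w) - M) * resolvent M (Complex.exp w) = 1 :=
      Ring.mul_inverse_cancel _ (spectrum.mem_resolventSet_iff.1 hwρ)
    -- `Log z (z - M)⁻¹ = Log M (z - M)⁻¹ + logQuotient M z` at `z = e ^ w`
    have h3 : logQuotient M (Complex.exp w) = w • resolvent M (Complex.exp w) -
        segLog (M - 1) * resolvent M (Complex.exp w) := by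
      rw [Algebra.smul_def, ← sub_mul, ← h1, mul_assoc, h2, mul_one]
    simp only [h3, mul_smul_comm]
    module
  · rw [uIcc_of_le (by linarith : -θ ≤ θ)] at hy
    simpa using abs_le.2 hy
  · rw [uIcc_of_le (by linarith : -θ ≤ θ)] at hy
    simpa using abs_le.2 hy

/-- A compact subset of the slit plane is contained in an annular sector. -/
lemma exists_annularSector {K : Set ℂ} (hK : IsCompact K) (hK' : K ⊆ Complex.slitPlane) :
    ∃ p : ℝ × ℝ × ℝ, p.1 < p.2.1 ∧ 0 < p.2.2 ∧ p.2.2 < Real.pi ∧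
      K ⊆ annularSector p.1 p.2.1 p.2.2 := by
  have hpi := Real.pi_pos
  have hlog : ContinuousOn Complex.log K := fun z hz =>
    (continuousAt_clog (hK' hz)).continuousWithinAt
  obtain ⟨B, hB⟩ := hK.exists_bound_of_continuousOn hlog
  obtain ⟨θ, hθ0, hθ, hθK⟩ : ∃ θ, 0 < θ ∧ θ < Real.pi ∧ ∀ z ∈ K, |z.arg| < θ := by
    rcases K.eq_empty_or_nonempty with rfl | hne
    · exact ⟨Real.pi / 2, by linarith, by linarith, by simp⟩
    obtain ⟨z, hz, hmax⟩ := hK.exists_isMaxOn hne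
      (f := fun z => |z.arg|) (fun z hz => (Complex.continuousAt_arg (hK' hz)).abs.continuousWithinAt)
    have h1 : |z.arg| < Real.pi := 
      abs_lt.2 ⟨Complex.neg_pi_lt_arg z, (Complex.arg_le_pi z).lt_of_ne
        (Complex.slitPlane_arg_ne_pi (hK' hz))⟩
    refine ⟨(|z.arg| + Real.pi) / 2, by positivity, by linarith, fun w hw => ?_⟩
    have : |w.arg| ≤ |z.arg| := hmax hw
    linarith
  refine ⟨(-(|B| + 1), |B| + 1, θ), by linarith [abs_nonneg B], hθ0, hθ, fun z hz => ?_⟩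
  refine ⟨Complex.log z, ?_, Complex.exp_log (Complex.slitPlane_ne_zero (hK' hz))⟩
  have h1 := abs_le.1 ((Complex.abs_re_le_norm _).trans ((hB z hz).trans (le_abs_self B)))
  exact ⟨by linarith, by linarith, by rw [Complex.log_im]; exact hθK z hz⟩

end Log

lemma rieszDunfordLog_eq_rectInt {X : Type*} [NormedAddCommGroup X] [NormedSpace ℂ X]
    (M : X →L[ℂ] X) (a b θ : ℝ) : rieszDunfordLog M a b θ = (2 * Real.pi * Complex.I : ℂ)⁻¹ •
      rectInt (fun w => (w * Complex.exp w) • resolvent M (Complex.exp w)) a b (-θ) θ := rfl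

/-- The principal logarithm of a bounded operator, as an integral along a segment. -/
lemma opLog_eq_segLog {X : Type*} [NormedAddCommGroup X] [NormedSpace ℂ X] [CompleteSpace X]
    {M : X →L[ℂ] X} (hM : spectrum ℂ M ⊆ Complex.slitPlane) : opLog M = segLog (M - 1) := by
  have h := exists_annularSector (spectrum.isCompact M) hM
  obtain ⟨-, h2, h3, h4⟩ := h.choose_spec
  have h5 := rectInt_log_resolvent h2 h3 h4
  rw [opLog, dif_pos h, rieszDunfordLog_eq_rectInt, h5, inv_smul_smul₀ Complex.two_pi_I_ne_zero]

/-! ### Everywhere defined bounded operators as unbounded operators -/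

section Bounded

variable {X : Type*} [NormedAddCommGroup X] [NormedSpace ℂ X]

/-- A bounded operator, viewed as an unbounded operator with full domain. -/
noncomputable def ofBounded (K : X →L[ℂ] X) : X →ₗ.[ℂ] X := K.toLinearMap.toPMap ⊤

lemma mem_ofBounded_domain (K : X →L[ℂ] X) (x : X) : x ∈ (ofBounded K).domain :=
  Submodule.mem_top

lemma ofBounded_apply (K : X →L[ℂ] X) (x : (ofBounded K).domain) : ofBounded K x = K x := rfl

lemma eq_ofBounded {M : X →ₗ.[ℂ] X} {K : X →L[ℂ] X}
    (h : ∀ x : X, ∃ hx : x ∈ M.domain, M ⟨x, hx⟩ = K x) : M = ofBounded K := by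
  refine (LinearPMap.eq_of_le_of_domain_eq (f := ofBounded K) (g := M)
    ⟨fun x _ => (h x).1, ?_⟩ ?_).symm
  · rintro ⟨x, hx⟩ ⟨y, hy⟩ hxy
    change x = y at hxy
    subst hxy
    exact (h x).2.symm
  · exact (eq_top_iff.2 fun x _ => (h x).1).symm

lemma opProduct_ofBounded (K L : X →L[ℂ] X) :
    opProduct (ofBounded K) (ofBounded L) = ofBounded (K * L) :=
  eq_ofBounded fun x =>
    ⟨⟨mem_ofBounded_domain L x, mem_ofBounded_domain K _⟩, rfl⟩

lemma compPMap_ofBounded (K L : X →L[ℂ] X) :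
    K.toLinearMap.compPMap (ofBounded L) = ofBounded (K * L) :=
  eq_ofBounded fun x => ⟨mem_ofBounded_domain L x, rfl⟩

lemma neg_ofBounded (K : X →L[ℂ] X) : -ofBounded K = ofBounded (-K) :=
  eq_ofBounded fun x => ⟨mem_ofBounded_domain K x, rfl⟩

/-- A closure extends the operator, and there is no proper extension of an everywhere defined
operator. -/
lemma closure_ofBounded (K : X →L[ℂ] X) : (ofBounded K).closure = ofBounded K := by
  refine (LinearPMap.eq_of_le_of_domain_eq (LinearPMap.le_closure _) ?_).symm
  exact (eq_top_iff.2 (LinearPMap.le_closure (ofBounded K)).1).symm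

lemma strongDeriv_eq_ofBounded {F : ℝ → X →L[ℂ] X} {F' : X →L[ℂ] X} {I : Set ℝ} {t : ℝ}
    (hd : HasDerivWithinAt F F' I t) (hI : UniqueDiffWithinAt ℝ I t) :
    strongDeriv F I t = ofBounded F' := by
  refine eq_ofBounded fun x => ?_
  have h : HasDerivWithinAt (fun r => F r x) (F' x) I t :=
    (((ContinuousLinearMap.apply ℂ X x).restrictScalars ℝ).hasFDerivAt).comp_hasDerivWithinAt t hd
  exact ⟨h.differentiableWithinAt, h.derivWithin hI⟩

lemma commute_of_commutesWith {K L : X →L[ℂ] X} (h : CommutesWith K (ofBounded L)) :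
    Commute K L := by
  ext x
  obtain ⟨_, h1⟩ := h ⟨x, mem_ofBounded_domain L x⟩
  exact h1.symm

lemma isResolvent_ofBounded {K R : X →L[ℂ] X} {z : ℂ} :
    IsResolvent (ofBounded K) z R ↔
      (algebraMap ℂ (X →L[ℂ] X) z - K) * R = 1 ∧ R * (algebraMap ℂ (X →L[ℂ] X) z - K) = 1 := by
  constructor
  · rintro ⟨h1, h2⟩
    constructor
    · ext x
      obtain ⟨_, h⟩ := h1 x
      simpa [Algebra.algebraMap_eq_smul_one, ofBounded_apply] using h
    · ext x
      simpa [Algebra.algebraMap_eq_smul_one, ofBounded_apply] using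
        h2 ⟨x, mem_ofBounded_domain K x⟩
  · rintro ⟨h1, h2⟩
    constructor
    · intro x
      refine ⟨mem_ofBounded_domain K _, ?_⟩
      have := DFunLike.congr_fun h1 x
      simpa [Algebra.algebraMap_eq_smul_one, ofBounded_apply] using this
    · intro x
      have := DFunLike.congr_fun h2 (x : X)
      simpa [Algebra.algebraMap_eq_smul_one, ofBounded_apply] using this

lemma IsResolvent.isUnit {K R : X →L[ℂ] X} {z : ℂ} (h : IsResolvent (ofBounded K) z R) :
    IsUnit (algebraMap ℂ (X →L[ℂ] X) z - K) :=
  let h' := isResolvent_ofBounded.1 h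
  ⟨⟨_, R, h'.1, h'.2⟩, rfl⟩

lemma unboundedResolvent_ofBounded {K : X →L[ℂ] X} {z : ℂ}
    (h : IsUnit (algebraMap ℂ (X →L[ℂ] X) z - K)) :
    unboundedResolvent (ofBounded K) z = resolvent K z := by
  have hex : ∃ R : X →L[ℂ] X, IsResolvent (ofBounded K) z R :=
    ⟨_, isResolvent_ofBounded.2 ⟨Ring.mul_inverse_cancel _ h, Ring.inverse_mul_cancel _ h⟩⟩
  rw [unboundedResolvent, dif_pos hex]
  have h1 := isResolvent_ofBounded.1 hex.choose_spec
  rw [resolvent, ← mul_one (Ring.inverse _), ← h1.1, Ring.inverse_mul_cancel_left _ _ h]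

end Bounded

/-! ### From strong to norm differentiability -/

section Strong

variable {X : Type*} [NormedAddCommGroup X] [NormedSpace ℂ X] {T : ℝ} {F G : ℝ → X →L[ℂ] X}

/-- The mean value inequality for a strongly differentiable family, with a norm estimate. -/
lemma norm_sub_le_of_strong_deriv {C : ℝ} {J : Set ℝ} (hJ : Convex ℝ J) (B : X →L[ℂ] X)
    (hC0 : 0 ≤ C)
    (hF : ∀ t ∈ J, ∀ x, HasDerivWithinAt (fun r => F r x) (G t x) J t)
    (hG : ∀ t ∈ J, ‖G t - B‖ ≤ C) {r t : ℝ} (hr : r ∈ J) (ht : t ∈ J) :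
    ‖F r - F t - (r - t) • B‖ ≤ C * |r - t| := by
  refine ContinuousLinearMap.opNorm_le_bound _ (by positivity) fun x => ?_
  have h := hJ.norm_image_sub_le_of_norm_hasDerivWithin_le
    (f := fun y => F y x - y • B x) (f' := fun y => G y x - B x) (C := C * ‖x‖)
    (fun y hy => ((hF y hy x).sub
      (by simpa using (hasDerivWithinAt_id y J).smul_const (B x)))) (fun y hy => by
      rw [← sub_apply]
      exact (ContinuousLinearMap.le_opNorm _ _).trans
        (mul_le_mul_of_nonneg_right (hG y hy) (norm_nonneg _))) ht hr
  have e : (F r - F t - (r - t) • B) x = F r x - r • B x - (F t x - t • B x) := by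
    simp only [sub_apply, smul_apply, sub_smul]
    abel
  rw [e]
  calc _ ≤ C * ‖x‖ * ‖r - t‖ := h
    _ = _ := by rw [Real.norm_eq_abs]; ring

lemma continuousWithinAt_of_strong_deriv {C : ℝ}
    (hF : ∀ t ∈ Icc 0 T, ∀ x, HasDerivWithinAt (fun r => F r x) (G t x) (Icc 0 T) t)
    (hG : ∀ t ∈ Icc 0 T, ‖G t‖ ≤ C) {t : ℝ} (ht : t ∈ Icc 0 T) :
    ContinuousWithinAt F (Icc 0 T) t := by
  have hC0 : 0 ≤ C := (norm_nonneg _).trans (hG t ht)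
  rw [ContinuousWithinAt, tendsto_iff_norm_sub_tendsto_zero]
  have h0 : Tendsto (fun r => C * |r - t|) (𝓝[Icc 0 T] t) (𝓝 0) := by
    have : ContinuousAt (fun r => C * |r - t|) t := by fun_prop
    simpa using this.tendsto.mono_left nhdsWithin_le_nhds
  refine squeeze_zero' (Eventually.of_forall fun _ => norm_nonneg _) ?_ h0
  filter_upwards [self_mem_nhdsWithin] with r hr
  simpa using norm_sub_le_of_strong_deriv (convex_Icc 0 T) 0 hC0 hF (by simpa using hG) hr ht

lemma hasDerivWithinAt_of_strong_deriv
    (hF : ∀ t ∈ Icc 0 T, ∀ x, HasDerivWithinAt (fun r => F r x) (G t x) (Icc 0 T) t)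
    {t : ℝ} (ht : t ∈ Icc 0 T) (hG : ContinuousWithinAt G (Icc 0 T) t) :
    HasDerivWithinAt F (G t) (Icc 0 T) t := by
  rw [hasDerivWithinAt_iff_isLittleO, Asymptotics.isLittleO_iff]
  intro ε hε
  obtain ⟨δ, hδ, h⟩ := Metric.continuousWithinAt_iff.1 hG ε hε
  filter_upwards [self_mem_nhdsWithin, mem_nhdsWithin_of_mem_nhds (Metric.ball_mem_nhds t hδ)]
    with r hr hr'
  have := norm_sub_le_of_strong_deriv (F := F) (G := G) (J := Icc 0 T ∩ Metric.ball t δ)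
    ((convex_Icc 0 T).inter (convex_ball t δ)) (G t) hε.le
    (fun y hy x => (hF y hy.1 x).mono inter_subset_left)
    (fun y hy => by rw [← dist_eq_norm]; exact (h hy.1 hy.2).le) ⟨hr, hr'⟩
    ⟨ht, Metric.mem_ball_self hδ⟩
  simpa using this

end Strong

/-! ### The generator of the second order problem is bounded -/

section Evolution

variable {X : Type*} [NormedAddCommGroup X] [NormedSpace ℂ X] [CompleteSpace X] {T : ℝ}
  {A : X →ₗ.[ℂ] X} {U V : ℝ → ℝ → X →L[ℂ] X}

/-- The uniform boundedness principle for `U` and `V`. -/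
lemma IsEvolutionOperator.exists_bound (hU : IsEvolutionOperator A T U V) :
    ∃ C, 0 ≤ C ∧ ∀ t ∈ Icc 0 T, ∀ s ∈ Icc 0 T, ‖V t s‖ ≤ C ∧ ‖U t s‖ ≤ C := by
  have key : ∀ W : ℝ → ℝ → X →L[ℂ] X,
      (∀ x : X, ContinuousOn (fun p : ℝ × ℝ => W p.1 p.2 x) (Icc 0 T ×ˢ Icc 0 T)) →
      ∃ C, ∀ t ∈ Icc 0 T, ∀ s ∈ Icc 0 T, ‖W t s‖ ≤ C := by
    intro W hW
    obtain ⟨C, hC⟩ := banach_steinhaus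
      (g := fun p : (Icc 0 T ×ˢ Icc 0 T : Set (ℝ × ℝ)) => W p.1.1 p.1.2) (fun x => by
        obtain ⟨C, hC⟩ := (isCompact_Icc.prod isCompact_Icc).exists_bound_of_continuousOn (hW x)
        exact ⟨C, fun p => hC p.1 p.2⟩)
    exact ⟨C, fun t ht s hs => hC ⟨(t, s), ht, hs⟩⟩
  obtain ⟨C, hC⟩ := key V hU.deriv_strong_cont
  obtain ⟨C', hC'⟩ := key U hU.strong_cont
  exact ⟨|C| + |C'|, by positivity, fun t ht s hs =>
    ⟨(hC t ht s hs).trans ((le_abs_self C).trans (le_add_of_nonneg_right (abs_nonneg _))),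
      (hC' t ht s hs).trans ((le_abs_self C').trans (le_add_of_nonneg_left (abs_nonneg _)))⟩⟩

/-- Since `U` has a bounded derivative, `U(r,0)` is close to the identity in norm for small `r`;
integrating `V' = A U` over a short interval `[0, h]`, the bounded operator `(V(h,0) - V(0,0)) / h`
is then close to `A`, in the sense that its product with `A⁻¹` is close to the identity. Hence `A`
is everywhere defined and bounded. -/
lemma IsEvolutionOperator.exists_eq_ofBounded (hT : 0 < T) (hA_dense : Dense (A.domain : Set X))
    (hA_inv : ∃ R : X →L[ℂ] X, IsResolvent A 0 R) (hU : IsEvolutionOperator A T U V) :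
    ∃ A₀ : X →L[ℂ] X, IsUnit A₀ ∧ A = ofBounded A₀ := by
  obtain ⟨R, hR1, hR2⟩ := hA_inv
  obtain ⟨C, hC0, hC⟩ := hU.exists_bound
  have h0 : (0 : ℝ) ∈ Icc 0 T := ⟨le_rfl, hT.le⟩
  -- `h` is so small that `U(r,0)` stays within `1/2` of the identity on `[0, h]`
  set h := min T (1 / (2 * (C + 1))) with hh
  have hh0 : 0 < h := lt_min hT (by positivity)
  have hhT : h ≤ T := min_le_left _ _
  have hhC : C * h ≤ 1 / 2 := by
    have : h ≤ 1 / (2 * (C + 1)) := min_le_right _ _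
    calc C * h ≤ (C + 1) * (1 / (2 * (C + 1))) := by gcongr; linarith
      _ = 1 / 2 := by field_simp
  have hsub : Icc 0 h ⊆ Icc 0 T := Icc_subset_Icc_right hhT
  have hUlip : ∀ r ∈ Icc 0 h, ‖U r 0 - 1‖ ≤ C * h := by
    intro r hr
    have := norm_sub_le_of_strong_deriv (F := fun r => U r 0) (G := fun r => V r 0)
      (convex_Icc 0 T) 0 hC0 (fun t ht x => hU.deriv t ht 0 h0 x)
      (by simpa using fun t h1 h2 => (hC t ⟨h1, h2⟩ 0 h0).1) (hsub hr) h0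
    simp only [smul_zero, sub_zero, hU.map_self 0 h0, abs_of_nonneg hr.1] at this
    exact this.trans (mul_le_mul_of_nonneg_left hr.2 hC0)
  set Q : X →L[ℂ] X := ((h⁻¹ : ℝ) : ℂ) • (V h 0 - V 0 0) with hQ
  -- `-R = A⁻¹`, and `-R V(r,0) x` has the derivative `U(r,0) x` for `x` in the domain of `A`
  have key : ∀ x : X, ‖-R (V h 0 x - V 0 0 x) - h • x‖ ≤ C * h * h * ‖x‖ := by
    intro x
    refine hA_dense.induction (P := fun x => ‖-R (V h 0 x - V 0 0 x) - h • x‖ ≤ C * h * h * ‖x‖)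
      (fun x hx => ?_) (isClosed_le (by fun_prop) (by fun_prop)) x
    have hder : ∀ r ∈ Icc 0 h, HasDerivWithinAt (fun r => -R (V r 0 x) - r • x)
        (U r 0 x - x) (Icc 0 h) r := by
      intro r hr
      obtain ⟨hmem, hd⟩ := hU.equation r (hsub hr) 0 h0 x hx
      have h1 : HasDerivWithinAt (fun r => R (V r 0 x)) (R (A ⟨U r 0 x, hmem⟩)) (Icc 0 h) r :=
        ((R.restrictScalars ℝ).hasFDerivAt).comp_hasDerivWithinAt r (hd.mono hsub)
      have h2 : -R (A ⟨U r 0 x, hmem⟩) = U r 0 x := by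
        have := hR2 ⟨U r 0 x, hmem⟩
        simpa using this
      rw [← h2]
      exact h1.neg.sub (by simpa using (hasDerivWithinAt_id r (Icc 0 h)).smul_const x)
    have := (convex_Icc 0 h).norm_image_sub_le_of_norm_hasDerivWithin_le hder
      (C := C * h * ‖x‖) (fun r hr => by
        have := (U r 0 - 1).le_opNorm x
        simp only [sub_apply, one_apply_eq_self] at this
        exact this.trans (mul_le_mul_of_nonneg_right (hUlip r hr) (norm_nonneg _)))
      ⟨le_rfl, hh0.le⟩ ⟨hh0.le, le_rfl⟩
    rw [sub_zero, Real.norm_eq_abs, abs_of_pos hh0, zero_smul, sub_zero] at this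
    calc _ = ‖-R (V h 0 x) - h • x - -R (V 0 0 x)‖ := by rw [map_sub]; congr 1; abel
      _ ≤ _ := this
      _ = _ := by ring
  have hnorm : ‖1 - (-R) * Q‖ < 1 := by
    refine lt_of_le_of_lt (ContinuousLinearMap.opNorm_le_bound _ (M := 1 / 2) (by norm_num)
      fun x => ?_) (by norm_num)
    have e : (1 - (-R) * Q) x = -((h⁻¹ : ℝ) • (-R (V h 0 x - V 0 0 x) - h • x)) := by
      simp only [hQ, sub_apply, one_apply_eq_self,
        mul_apply_eq_comp, neg_apply, Complex.coe_smul,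
        smul_apply, smul_sub, smul_smul, inv_mul_cancel₀ hh0.ne', one_smul,
        smul_neg]
      have hs : R (h⁻¹ • (V h 0 x - V 0 0 x)) = h⁻¹ • R (V h 0 x - V 0 0 x) :=
        (R.restrictScalars ℝ).map_smul _ _
      rw [← smul_sub, hs]
      abel
    rw [e, norm_neg, norm_smul, Real.norm_eq_abs, abs_of_pos (inv_pos.2 hh0)]
    calc h⁻¹ * _ ≤ h⁻¹ * (C * h * h * ‖x‖) := by gcongr; exact key x
      _ = C * h * ‖x‖ := by field_simp
      _ ≤ _ := by gcongr
  obtain ⟨B, hB⟩ : ∃ B, (-R) * Q * B = 1 := by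
    have := isUnit_one_sub_of_norm_lt_one hnorm
    rw [sub_sub_cancel] at this
    exact this.exists_right_inv
  -- `-R` is injective and has the right inverse `Q B`, which is therefore `A`
  have hinj : ∀ x y, R x = R y → x = y := by
    have hz : ∀ x, R x = 0 → x = 0 := by
      intro x hx
      obtain ⟨hm, he⟩ := hR1 x
      have : (⟨R x, hm⟩ : A.domain) = 0 := Subtype.ext hx
      rw [this, LinearPMap.map_zero] at he
      simpa using he.symm
    intro x y hxy
    exact sub_eq_zero.1 (hz _ (by rw [map_sub, hxy, sub_self]))
  have hRB : ∀ x, R (-(Q * B) x) = x := by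
    intro x
    have := DFunLike.congr_fun hB x
    rw [map_neg]
    exact this
  have hA : A = ofBounded (Q * B) := by
    refine eq_ofBounded fun x => ?_
    have hmem : x ∈ A.domain := by
      obtain ⟨hm, -⟩ := hR1 (-(Q * B) x)
      rwa [hRB] at hm
    refine ⟨hmem, ?_⟩
    have h1 := hR2 ⟨x, hmem⟩
    rw [zero_smul, zero_sub] at h1
    exact neg_injective (hinj _ _ (h1.trans (hRB x).symm))
  refine ⟨Q * B, ⟨⟨Q * B, -R, ?_, by rw [← hB, mul_assoc]⟩, rfl⟩, hA⟩
  ext x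
  obtain ⟨hm, he⟩ := hR1 x
  have h2 : ∀ M : X →ₗ.[ℂ] X, M = ofBounded (Q * B) → ∀ y (hy : y ∈ M.domain),
      M ⟨y, hy⟩ = (Q * B) y := by
    rintro _ rfl y hy
    rfl
  rw [h2 A hA, zero_smul, zero_sub] at he
  simpa using he

end Evolution

/-! ### The logarithmic representation -/

section LogRepresentation

variable {X : Type*} [NormedAddCommGroup X] [NormedSpace ℂ X] [CompleteSpace X]

lemma spectrum_subset_slitPlane {𝔸 : Type*} [NormedRing 𝔸] [NormedAlgebra ℂ 𝔸] {M : 𝔸}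
    (hM : SegUnit (M - 1)) : spectrum ℂ M ⊆ Complex.slitPlane := by
  intro z hz
  by_contra hc
  rw [Complex.mem_slitPlane_iff_not_le_zero, not_not] at hc
  obtain ⟨x, hx, rfl⟩ : ∃ x : ℝ, x ≤ 0 ∧ (x : ℂ) = z := by
    rw [Complex.le_def] at hc
    exact ⟨z.re, hc.1, Complex.ext rfl hc.2.symm⟩
  have h1x : 0 < 1 - x := by linarith
  have hu := hM (1 - x)⁻¹ ⟨(inv_pos.2 h1x).le, inv_le_one_of_one_le₀ (by linarith)⟩
  have hu' : IsUnit (-(1 - x : ℂ)) := by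
    rw [isUnit_iff_ne_zero, neg_ne_zero]
    exact_mod_cast h1x.ne'
  refine hz ?_
  have h2 : algebraMap ℂ 𝔸 x - M =
      algebraMap ℂ 𝔸 (-(1 - x : ℂ)) * (1 + (((1 - x)⁻¹ : ℝ) : ℂ) • (M - 1)) := by
    have h1c : (1 - x : ℂ) ≠ 0 := by exact_mod_cast h1x.ne'
    rw [mul_add, mul_one, mul_smul_comm, ← Algebra.smul_def, smul_smul,
      Algebra.algebraMap_eq_smul_one, Algebra.algebraMap_eq_smul_one]
    rw [show (((1 - x)⁻¹ : ℝ) : ℂ) * -(1 - x : ℂ) = -1 by push_cast; field_simp]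
    module
  rw [spectrum.mem_resolventSet_iff, h2]
  exact (hu'.map _).mul hu

/-- If the derivative of `F` at `t` commutes with `F t`, the logarithmic representation of `F` at
`t` is the logarithmic derivative `F(t)⁻¹ F'(t)`: the factor `I - κ e^(-α)` is
`F(t) (F(t) + κ)⁻¹`, and `∂α = F'(t) (F(t) + κ)⁻¹`. -/
lemma logRepresentation_eq_ofBounded {κ : ℂ} {F : ℝ → X →L[ℂ] X} {F' : X →L[ℂ] X} {I : Set ℝ}
    {t : ℝ} (hd : HasDerivWithinAt F F' I t) (hI : UniqueDiffWithinAt ℝ I t)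
    (hcomm : Commute (F t) F') (hdef : LogRepresentationDefined κ F t) :
    IsUnit (F t) ∧ logRepresentation κ F I t = ofBounded (Ring.inverse (F t) * F') := by
  obtain ⟨hσ, hfac⟩ := hdef
  have hseg := segUnit_of_spectrum hσ
  set M : X →L[ℂ] X := F t + κ • (1 : X →L[ℂ] X) with hM
  have hMunit : IsUnit M := by
    have := hseg 1 ⟨zero_le_one, le_rfl⟩
    simpa using this
  have hinv : segInv (M - 1) 1 = Ring.inverse M := by simp [segInv]
  have hcM : Commute F' M := hcomm.symm.add_right ((Commute.one_right _).smul_right _)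
  have hdN : HasDerivWithinAt (fun r => F r + κ • (1 : X →L[ℂ] X) - 1) F' I t :=
    (hd.add_const _).sub_const _
  have hlog : HasDerivWithinAt (shiftedLog κ F) (F' * Ring.inverse M) I t := by
    have h1 := hasDerivWithinAt_segLog hdN hseg (hcM.sub_right (Commute.one_right _))
    rw [← hM, hinv] at h1
    refine h1.congr_of_eventuallyEq ?_ (opLog_eq_segLog hσ)
    obtain ⟨C, hC⟩ := hseg.eventually
    filter_upwards [hdN.continuousWithinAt.tendsto.eventually hC] with r hr
    exact opLog_eq_segLog (spectrum_subset_slitPlane hr.1)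
  have hfac_eq : logFactor κ F t = F t * Ring.inverse M := by
    rw [logFactor, shiftedLog, ← hM, opLog_eq_segLog hσ, exp_neg_segLog hseg, hinv]
    have h1 := Ring.mul_inverse_cancel M hMunit
    nth_rewrite 1 [← h1]
    rw [hM, add_mul, smul_mul_assoc, one_mul, add_sub_cancel_right]
  have hF : IsUnit (F t) := by
    have h1 : F t = logFactor κ F t * M := by
      rw [hfac_eq, Ring.inverse_mul_cancel_right _ _ hMunit]
    rw [h1]
    exact hfac.mul hMunit
  refine ⟨hF, ?_⟩
  have hFM : Commute (F t) M := (Commute.refl _).add_right ((Commute.one_right _).smul_right _)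
  rw [logRepresentation, strongDeriv_eq_ofBounded hlog hI, compPMap_ofBounded]
  congr 1
  -- both sides become `F' (F(t) + κ)⁻¹` after multiplication by `F(t) (F(t) + κ)⁻¹` on the left
  have h1 : logFactor κ F t * (Ring.inverse (F t) * F') = F' * Ring.inverse M := by
    rw [hfac_eq, (commute_ringInverse hFM).eq, mul_assoc,
      Ring.mul_inverse_cancel_left _ _ hF, ← (commute_ringInverse hcM).eq]
  rw [← h1, Ring.inverse_mul_cancel_left _ _ hfac]

end LogRepresentation

/-! ### The square root -/

section Sqrt

lemma image_tan_sq : (fun φ : ℝ => Real.tan φ ^ 2) '' Ioo 0 (Real.pi / 2) = Ioi 0 := by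
  ext r
  constructor
  · rintro ⟨φ, hφ, rfl⟩
    exact pow_pos (Real.tan_pos_of_pos_of_lt_pi_div_two hφ.1 hφ.2) 2
  · intro hr
    refine ⟨Real.arctan (√r), ⟨?_, Real.arctan_lt_pi_div_two _⟩, ?_⟩
    · exact Real.arctan_pos.2 (Real.sqrt_pos.2 hr)
    · simp only [Real.tan_arctan]
      exact Real.sq_sqrt (le_of_lt hr)

lemma injOn_tan_sq : InjOn (fun φ : ℝ => Real.tan φ ^ 2) (Ioo 0 (Real.pi / 2)) := by
  intro φ hφ ψ hψ h
  have h1 := Real.tan_pos_of_pos_of_lt_pi_div_two hφ.1 hφ.2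
  have h2 := Real.tan_pos_of_pos_of_lt_pi_div_two hψ.1 hψ.2
  have h3 : Real.tan φ = Real.tan ψ := (pow_left_inj₀ h1.le h2.le two_ne_zero).1 h
  have hpi := Real.pi_pos
  exact Real.injOn_tan ⟨by linarith [hφ.1], hφ.2⟩ ⟨by linarith [hψ.1], hψ.2⟩ h3

lemma hasDerivAt_tan_sq {φ : ℝ} (hφ : φ ∈ Ioo 0 (Real.pi / 2)) :
    HasDerivAt (fun φ : ℝ => Real.tan φ ^ 2) (2 * Real.tan φ * (1 / Real.cos φ ^ 2)) φ := by
  have hc : Real.cos φ ≠ 0 := (Real.cos_pos_of_mem_Ioo ⟨by linarith [hφ.1, Real.pi_pos], hφ.2⟩).ne'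
  simpa using (Real.hasDerivAt_tan hc).fun_pow 2

variable {X : Type*} [NormedAddCommGroup X] [NormedSpace ℂ X]

/-- The Balakrishnan integrand of a bounded operator `A` after the substitution `r = tan²φ`. -/
lemma sqrtIntegrand_tan_sq {A : X →L[ℂ] X} (hA : SegUnit (A - 1)) {φ : ℝ}
    (hφ : φ ∈ Ioo 0 (Real.pi / 2)) (x : (ofBounded A).domain) :
    |2 * Real.tan φ * (1 / Real.cos φ ^ 2)| • sqrtIntegrand (ofBounded A) x (Real.tan φ ^ 2) =
      (2 : ℝ) • (segInv (A - 1) (Real.cos φ ^ 2) * A) (x : X) := by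
  have htan := Real.tan_pos_of_pos_of_lt_pi_div_two hφ.1 hφ.2
  have hcos : 0 < Real.cos φ := Real.cos_pos_of_mem_Ioo ⟨by linarith [hφ.1, Real.pi_pos], hφ.2⟩
  have hcosc : (Real.cos φ : ℂ) ≠ 0 := by exact_mod_cast hcos.ne'
  have hu := hA (Real.cos φ ^ 2) (cos_sq_mem_Icc φ)
  have hts : Real.tan φ ^ 2 = (1 - Real.cos φ ^ 2) / Real.cos φ ^ 2 := by
    rw [Real.tan_eq_sin_div_cos, div_pow, Real.sin_sq]
  have hz : algebraMap ℂ (X →L[ℂ] X) (-((Real.tan φ ^ 2 : ℝ) : ℂ)) - A =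
      algebraMap ℂ (X →L[ℂ] X) (-((Real.cos φ : ℂ) ^ 2)⁻¹) *
        (1 + ((Real.cos φ ^ 2 : ℝ) : ℂ) • (A - 1)) := by
    rw [mul_add, mul_one, mul_smul_comm, ← Algebra.smul_def, smul_smul,
      Algebra.algebraMap_eq_smul_one, Algebra.algebraMap_eq_smul_one, hts]
    push_cast
    have e1 : (Complex.cos φ : ℂ) ^ 2 * -((Complex.cos φ) ^ 2)⁻¹ = -1 := by
      rw [← Complex.ofReal_cos]; field_simp
    have e2 : (1 - Complex.cos φ ^ 2) / Complex.cos φ ^ 2 = (Complex.cos φ ^ 2)⁻¹ - 1 := by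
      rw [← Complex.ofReal_cos]; field_simp
    rw [e1, e2]
    module
  have hcu : IsUnit (algebraMap ℂ (X →L[ℂ] X) (-((Real.cos φ : ℂ) ^ 2)⁻¹)) :=
    (isUnit_iff_ne_zero.2 (neg_ne_zero.2 (inv_ne_zero (pow_ne_zero 2 hcosc)))).map _
  have hres : -resolvent A (-((Real.tan φ ^ 2 : ℝ) : ℂ)) =
      ((Real.cos φ ^ 2 : ℝ) : ℂ) • segInv (A - 1) (Real.cos φ ^ 2) := by
    have h1 : (-(((Real.cos φ ^ 2 : ℝ) : ℂ) • segInv (A - 1) (Real.cos φ ^ 2))) *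
        (algebraMap ℂ (X →L[ℂ] X) (-((Real.tan φ ^ 2 : ℝ) : ℂ)) - A) = 1 := by
      rw [hz, ← Algebra.smul_def, mul_smul_comm, neg_mul, smul_mul_assoc,
        segInv_mul hA (cos_sq_mem_Icc φ), smul_neg, neg_smul, neg_neg, smul_smul]
      push_cast
      rw [← Complex.ofReal_cos, inv_mul_cancel₀ (pow_ne_zero 2 hcosc), one_smul]
    have hzu := hz ▸ hcu.mul hu
    have h2 := Ring.mul_inverse_cancel_right _
      (-(((Real.cos φ ^ 2 : ℝ) : ℂ) • segInv (A - 1) (Real.cos φ ^ 2))) hzu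
    rw [h1, one_mul] at h2
    rw [resolvent, h2, neg_neg]
  have hpow : (Real.tan φ ^ 2) ^ (-(1 / 2) : ℝ) = (Real.tan φ)⁻¹ := by
    rw [Real.rpow_neg (sq_nonneg _), ← Real.sqrt_eq_rpow, Real.sqrt_sq htan.le]
  rw [sqrtIntegrand, unboundedResolvent_ofBounded (hz ▸ hcu.mul hu), ← neg_apply, hres, hpow,
    abs_of_pos (by positivity), ofBounded_apply, smul_apply, Complex.coe_smul, smul_smul, smul_smul,
    mul_apply_eq_comp]
  congr 1
  field_simp

/-- For a bounded operator `A` such that the segment from `1` to `A` is invertible, the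
Balakrishnan operator is everywhere defined and equals `A^(-1/2) A`. -/
lemma opSqrt_ofBounded [CompleteSpace X] {A : X →L[ℂ] X} (hA : SegUnit (A - 1)) :
    opSqrt (ofBounded A) = ofBounded (segInvSqrt (A - 1) * A) := by
  have hmeas : MeasurableSet (Ioo 0 (Real.pi / 2)) := measurableSet_Ioo
  have hder : ∀ φ ∈ Ioo 0 (Real.pi / 2), HasDerivWithinAt (fun φ : ℝ => Real.tan φ ^ 2)
      (2 * Real.tan φ * (1 / Real.cos φ ^ 2)) (Ioo 0 (Real.pi / 2)) φ :=
    fun φ hφ => (hasDerivAt_tan_sq hφ).hasDerivWithinAt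
  have hcont := continuous_segInv_cos_sq hA
  have hpi := Real.pi_pos
  rw [opSqrt, ← closure_ofBounded (segInvSqrt (A - 1) * A)]
  congr 1
  refine eq_ofBounded fun x => ?_
  have hcx : Continuous fun φ : ℝ => (2 : ℝ) • (segInv (A - 1) (Real.cos φ ^ 2) * A) x := by
    fun_prop
  have hint : IntegrableOn (sqrtIntegrand (ofBounded A) ⟨x, mem_ofBounded_domain A x⟩) (Ioi 0) := by
    rw [← image_tan_sq, integrableOn_image_iff_integrableOn_abs_deriv_smul hmeas hder injOn_tan_sq]
    refine IntegrableOn.congr_fun ?_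
      (fun φ hφ => (sqrtIntegrand_tan_sq hA hφ ⟨x, mem_ofBounded_domain A x⟩).symm) hmeas
    exact hcx.integrableOn_Icc.mono_set Ioo_subset_Icc_self
  refine ⟨⟨mem_ofBounded_domain A x, hint⟩, ?_⟩
  change (Real.pi⁻¹ : ℝ) • ∫ r in Ioi (0 : ℝ),
    sqrtIntegrand (ofBounded A) ⟨x, mem_ofBounded_domain A x⟩ r = (segInvSqrt (A - 1) * A) x
  rw [← image_tan_sq, integral_image_eq_integral_abs_deriv_smul hmeas hder injOn_tan_sq,
    setIntegral_congr_fun hmeas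
      (fun φ hφ => sqrtIntegrand_tan_sq hA hφ ⟨x, mem_ofBounded_domain A x⟩),
    ← integral_Ioc_eq_integral_Ioo, ← intervalIntegral.integral_of_le (by positivity),
    intervalIntegral.integral_smul]
  have happ := (ContinuousLinearMap.apply ℂ X (A x)).intervalIntegral_comp_comm
    (hcont.intervalIntegrable (μ := volume) 0 (Real.pi / 2))
  have happ' : ∫ φ in (0 : ℝ)..(Real.pi / 2), (segInv (A - 1) (Real.cos φ ^ 2) * A) x =
      (∫ φ in (0 : ℝ)..(Real.pi / 2), segInv (A - 1) (Real.cos φ ^ 2)) (A x) := happ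
  rw [happ', smul_smul, mul_apply_eq_comp, segInvSqrt, smul_apply, Complex.coe_smul]
  congr 1
  ring

end Sqrt

/-! ### Semigroups and solutions -/

section Semigroup

variable {X : Type*} [NormedAddCommGroup X] [NormedSpace ℂ X] [CompleteSpace X]

lemma hasDerivAt_exp_smul (S : X →L[ℂ] X) (τ : ℝ) :
    HasDerivAt (fun τ : ℝ => NormedSpace.exp (τ • S)) (NormedSpace.exp (τ • S) * S) τ :=
  hasDerivAt_exp_smul_const S τ

lemma isSemigroupGeneratedBy_exp (S : X →L[ℂ] X) :
    IsSemigroupGeneratedBy (ofBounded S) (fun τ : ℝ => NormedSpace.exp (τ • S)) where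
  map_zero := by simp
  map_add r τ _ _ := by
    let _ : NormedAlgebra ℚ (X →L[ℂ] X) := NormedAlgebra.restrictScalars ℚ ℂ (X →L[ℂ] X)
    rw [add_smul, NormedSpace.exp_add_of_commute]
    exact ((Commute.refl S).smul_right _).smul_left _
  strong_cont x := by
    have h : Continuous (fun τ : ℝ => NormedSpace.exp (τ • S)) :=
      continuous_iff_continuousAt.2 fun τ => (hasDerivAt_exp_smul S τ).continuousAt
    exact (h.clm_apply continuous_const).continuousOn
  generator := by
    have h := (hasDerivAt_exp_smul S 0).hasDerivWithinAt (s := Ici 0)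
    rw [zero_smul, NormedSpace.exp_zero, one_mul] at h
    exact strongDeriv_eq_ofBounded h (uniqueDiffOn_Ici 0 0 self_mem_Ici)

/-- Solutions of `w' = S w` on `[0, T]` are given by the exponential. -/
lemma eq_exp_smul_of_hasDerivWithinAt {T : ℝ} (S : X →L[ℂ] X) {w : ℝ → X}
    (hw : ∀ τ ∈ Icc 0 T, HasDerivWithinAt w (S (w τ)) (Icc 0 T) τ) :
    ∀ τ ∈ Icc 0 T, w τ = NormedSpace.exp (τ • S) (w 0) := by
  intro τ hτ
  let _ : NormedAlgebra ℚ (X →L[ℂ] X) := NormedAlgebra.restrictScalars ℚ ℂ (X →L[ℂ] X)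
  have hder : ∀ τ ∈ Icc 0 T, HasDerivWithinAt (fun τ : ℝ => NormedSpace.exp (τ • -S) (w τ)) 0
      (Icc 0 T) τ := by
    intro τ hτ
    have h1 := (hasDerivAt_exp_smul (-S) τ).hasDerivWithinAt (s := Icc 0 T)
    have h2 := HasDerivWithinAt.clm_apply
      (c := fun τ : ℝ => (NormedSpace.exp (τ • -S)).restrictScalars ℝ) (u := w)
      (c' := (NormedSpace.exp (τ • -S) * -S).restrictScalars ℝ)
      ((ContinuousLinearMap.restrictScalarsL ℂ X X ℝ ℝ).hasFDerivAt.comp_hasDerivWithinAt τ h1)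
      (hw τ hτ)
    refine h2.congr_deriv ?_
    simp
  have hc := constant_of_derivWithin_zero (fun σ hσ => (hder σ hσ).differentiableWithinAt)
    (fun σ hσ => (hder σ (Ico_subset_Icc_self hσ)).derivWithin
      (uniqueDiffOn_Icc (hσ.1.trans_lt hσ.2) σ (Ico_subset_Icc_self hσ))) τ hτ
  simp only [zero_smul, NormedSpace.exp_zero, one_apply_eq_self] at hc
  have hmul : NormedSpace.exp (τ • S) * NormedSpace.exp (τ • -S) = 1 := by
    rw [← NormedSpace.exp_add_of_commute
      ((((Commute.refl S).neg_right).smul_right _).smul_left _), smul_neg, add_neg_cancel,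
      NormedSpace.exp_zero]
  rw [← hc, ← mul_apply_eq_comp, hmul, one_apply_eq_self]

/-- A solution `u` of `u'' = S² u` is decomposed by means of `u' + S u` and `u' - S u`, which solve
`w' = S w` and `w' = -S w`. -/
lemma exists_decomposition {T : ℝ} {S : X →L[ℂ] X} (hS : IsUnit S) {u v : ℝ → X}
    (hu : ∀ τ ∈ Icc 0 T, HasDerivWithinAt u (v τ) (Icc 0 T) τ)
    (hv : ∀ τ ∈ Icc 0 T, HasDerivWithinAt v (S (S (u τ))) (Icc 0 T) τ) :
    ∃ uplus uminus : X, ∀ τ ∈ Icc 0 T, u τ = NormedSpace.exp (τ • S) uplus +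
      NormedSpace.exp (τ • -S) uminus := by
  have hSu : ∀ τ ∈ Icc 0 T, HasDerivWithinAt (fun τ => S (u τ)) (S (v τ)) (Icc 0 T) τ :=
    fun τ hτ => ((S.restrictScalars ℝ).hasFDerivAt).comp_hasDerivWithinAt τ (hu τ hτ)
  have hp := eq_exp_smul_of_hasDerivWithinAt S (w := fun τ => v τ + S (u τ)) (fun τ hτ =>
    ((hv τ hτ).add (hSu τ hτ)).congr_deriv (by rw [map_add, add_comm]))
  have hm := eq_exp_smul_of_hasDerivWithinAt (-S) (w := fun τ => v τ - S (u τ)) (fun τ hτ =>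
    ((hv τ hτ).sub (hSu τ hτ)).congr_deriv (by simp))
  obtain ⟨B, hB⟩ := hS.exists_left_inv
  have hBS : ∀ y, B (S y) = y := fun y => DFunLike.congr_fun hB y
  have hcomm : ∀ (Q : X →L[ℂ] X), Commute Q S → ∀ y, Q (B y) = B (Q y) := by
    intro Q hQ y
    have h1 : S * B = 1 := by
      obtain ⟨s, rfl⟩ := hS
      rw [left_inv_eq_right_inv hB s.mul_inv, s.mul_inv]
    have h2 : Q * B = B * Q := by
      calc Q * B = B * S * Q * B := by rw [hB, one_mul]
        _ = B * (Q * S) * B := by rw [mul_assoc B S Q, hQ.eq]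
        _ = B * Q * (S * B) := by simp only [mul_assoc]
        _ = B * Q := by rw [h1, mul_one]
    exact DFunLike.congr_fun h2 y
  let _ : NormedAlgebra ℚ (X →L[ℂ] X) := NormedAlgebra.restrictScalars ℚ ℂ (X →L[ℂ] X)
  have hcp : ∀ τ : ℝ, Commute (NormedSpace.exp (τ • S)) S := fun τ =>
    (((Commute.refl S).smul_right τ).exp_right).symm
  have hcm : ∀ τ : ℝ, Commute (NormedSpace.exp (τ • -S)) S := fun τ =>
    ((((Commute.refl S).neg_right).smul_right τ).exp_right).symm
  refine ⟨(2⁻¹ : ℂ) • B (v 0 + S (u 0)), -((2⁻¹ : ℂ) • B (v 0 - S (u 0))), fun τ hτ => ?_⟩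
  rw [map_neg, map_smul, map_smul, hcomm _ (hcp τ), hcomm _ (hcm τ), ← hp τ hτ, ← hm τ hτ, map_add,
    map_sub, hBS]
  module

end Semigroup

/-! ### Sectorial bounded operators -/

section Sectorial

variable {X : Type*} [NormedAddCommGroup X] [NormedSpace ℂ X]

/-- A sectorial bounded invertible operator has no spectrum on `(-∞, 0]`. -/
lemma segUnit_of_isSectorial {A : X →L[ℂ] X} (hA : IsUnit A) (hsect : IsSectorial (ofBounded A)) :
    SegUnit (A - 1) := by
  refine segUnit_of_spectrum fun z hz => ?_
  by_contra hc
  rw [Complex.mem_slitPlane_iff_arg, not_and_or, not_not, not_not] at hc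
  rcases hc with hc | rfl
  · obtain ⟨-, -, ω, hω0, hω, h⟩ := hsect
    obtain ⟨C, hC⟩ := h ((ω + Real.pi) / 2) (by linarith) (by linarith)
    obtain ⟨R, hR, -⟩ := hC z (by rw [hc, abs_of_pos Real.pi_pos]; linarith)
    exact hz hR.isUnit
  · refine hz ?_
    rw [spectrum.mem_resolventSet_iff, map_zero, zero_sub]
    exact hA.neg

end Sectorial

/-! ### Representation of the infinitesimal generator -/

theorem mainTheorem2 {X : Type*} [NormedAddCommGroup X] [NormedSpace ℂ X] [CompleteSpace X]
    {T : ℝ} (hT : 0 < T)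
    (A : X →ₗ.[ℂ] X) (hA_closed : A.IsClosed) (hA_dense : Dense (A.domain : Set X))
    (hA_inv : ∃ R : X →L[ℂ] X, IsResolvent A 0 R)
    (U V : ℝ → ℝ → X →L[ℂ] X) (hU : IsEvolutionOperator A T U V)
    -- `∂ₜ U(t,s)` and `∂ₜ² U(t,s)` are sectorial
    (hU_sect : ∀ t ∈ Set.Icc 0 T, ∀ s ∈ Set.Icc 0 T,
      IsSectorial (strongDeriv (fun r => U r s) (Set.Icc 0 T) t))
    (hV_sect : ∀ t ∈ Set.Icc 0 T, ∀ s ∈ Set.Icc 0 T,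
      IsSectorial (strongDeriv (fun r => V r s) (Set.Icc 0 T) t))
    (t s : ℝ) (ht : t ∈ Set.Icc 0 T) (hs : s ∈ Set.Icc 0 T)
    -- `U(t,s)`, `∂ₜ U(t,s)` and `∂ₜ² U(t,s)` commute
    (hUV : Commute (U t s) (V t s))
    (hUW : CommutesWith (U t s) (strongDeriv (fun r => V r s) (Set.Icc 0 T) t))
    (hVW : CommutesWith (V t s) (strongDeriv (fun r => V r s) (Set.Icc 0 T) t))
    -- the two logarithmic representations are well defined
    (κ : ℂ)
    (hU_log : LogRepresentationDefined κ (fun r => U r s) t)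
    (hV_log : LogRepresentationDefined κ (fun r => V r s) t)
    -- `P` is the product of the two representations, in either order
    (P : X →ₗ.[ℂ] X)
    (hP : P = opProduct (logRepresentation κ (fun r => V r s) (Set.Icc 0 T) t)
            (logRepresentation κ (fun r => U r s) (Set.Icc 0 T) t) ∨
          P = opProduct (logRepresentation κ (fun r => U r s) (Set.Icc 0 T) t)
            (logRepresentation κ (fun r => V r s) (Set.Icc 0 T) t)) :
    P = A ∧ opProduct (opSqrt P) (opSqrt P) = A ∧
    ∃ Splus Sminus : ℝ → X →L[ℂ] X,
      IsSemigroupGeneratedBy (opSqrt P) Splus ∧ IsSemigroupGeneratedBy (-opSqrt P) Sminus ∧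
      (∀ u : ℝ → X, IsSolution A T u →
        ∃ uplus uminus : X, ∀ τ ∈ Set.Icc 0 T, u τ = Splus τ uplus + Sminus τ uminus) ∧
      (∀ r ∈ Set.Icc 0 T, ∀ u₀ : X,
        ∃ uplus uminus : X, ∀ τ ∈ Set.Icc 0 T,
          U τ r u₀ = Splus τ uplus + Sminus τ uminus) := by
  obtain ⟨A₀, hA₀, rfl⟩ := hU.exists_eq_ofBounded hT hA_dense hA_inv
  obtain ⟨C, hC0, hC⟩ := hU.exists_bound
  have hI : ∀ r ∈ Icc 0 T, UniqueDiffWithinAt ℝ (Icc 0 T) r := uniqueDiffOn_Icc hT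
  -- `U(·,q)` and `V(·,q)` are differentiable in norm, as `A` is bounded
  have hVd' : ∀ q ∈ Icc 0 T, ∀ r ∈ Icc 0 T, ∀ x,
      HasDerivWithinAt (fun r => V r q x) ((A₀ * U r q) x) (Icc 0 T) r := by
    intro q hq r hr x
    obtain ⟨_, h⟩ := hU.equation r hr q hq x (mem_ofBounded_domain A₀ x)
    exact h
  have hUd : ∀ q ∈ Icc 0 T, ∀ r ∈ Icc 0 T,
      HasDerivWithinAt (fun r => U r q) (V r q) (Icc 0 T) r := fun q hq r hr =>
    hasDerivWithinAt_of_strong_deriv (fun r hr x => hU.deriv r hr q hq x) hr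
      (continuousWithinAt_of_strong_deriv (C := ‖A₀‖ * C) (hVd' q hq) (fun y hy =>
        (norm_mul_le _ _).trans (mul_le_mul_of_nonneg_left (hC y hy q hq).2 (norm_nonneg _))) hr)
  have hVd : ∀ q ∈ Icc 0 T, ∀ r ∈ Icc 0 T,
      HasDerivWithinAt (fun r => V r q) (A₀ * U r q) (Icc 0 T) r := fun q hq r hr =>
    hasDerivWithinAt_of_strong_deriv (hVd' q hq) hr
      (continuousWithinAt_const.mul (hUd q hq r hr).continuousWithinAt)
  -- at `t = s` the sectorial operator `∂ₜ² U(s,s)` is `A`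
  have hseg : SegUnit (A₀ - 1) := by
    refine segUnit_of_isSectorial hA₀ ?_
    have h := hV_sect s hs s hs
    rwa [strongDeriv_eq_ofBounded (hVd s hs s hs) (hI s hs), hU.map_self s hs, mul_one] at h
  rw [strongDeriv_eq_ofBounded (hVd s hs t ht) (hI t ht)] at hUW hVW
  have hcU := commute_of_commutesWith hUW
  have hcV := commute_of_commutesWith hVW
  obtain ⟨huU, hrepU⟩ := logRepresentation_eq_ofBounded (hUd s hs t ht) (hI t ht) hUV hU_log
  obtain ⟨huV, hrepV⟩ := logRepresentation_eq_ofBounded (hVd s hs t ht) (hI t ht) hcV hV_log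
  have hPA : P = ofBounded A₀ := by
    rw [hrepU, hrepV, opProduct_ofBounded, opProduct_ofBounded] at hP
    have hUA : U t s * A₀ = A₀ * U t s :=
      huU.mul_right_cancel (by rw [mul_assoc, hcU.eq])
    have hVA : V t s * A₀ = A₀ * V t s :=
      huU.mul_right_cancel (by rw [mul_assoc, hcV.eq, mul_assoc, hUV.eq, mul_assoc])
    -- the products are `V⁻¹ A U U⁻¹ V` and `U⁻¹ V V⁻¹ A U`
    rcases hP with rfl | rfl
    · rw [← hUA, mul_assoc, ← mul_assoc (U t s * A₀), hUA, Ring.mul_inverse_cancel_right _ _ huU,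
        ← hVA, Ring.inverse_mul_cancel_left _ _ huV]
    · rw [mul_assoc, Ring.mul_inverse_cancel_left _ _ huV, ← hUA,
        Ring.inverse_mul_cancel_left _ _ huU]
  subst hPA
  have hK := segInvSqrt_mul_self hseg
  rw [add_sub_cancel] at hK
  set K := segInvSqrt (A₀ - 1) with hKdef
  have hcK : Commute A₀ K :=
    commute_segInvSqrt ((Commute.refl A₀).sub_right (Commute.one_right A₀)) hseg
  have hSS : K * A₀ * (K * A₀) = A₀ := by
    rw [mul_assoc, ← mul_assoc A₀ K, hcK.eq, ← mul_assoc, ← mul_assoc, hK, one_mul]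
  have hS : IsUnit (K * A₀) := by
    refine IsUnit.mul ⟨⟨K, K * A₀, ?_, ?_⟩, rfl⟩ hA₀
    · rw [← mul_assoc, hK]
    · rw [mul_assoc, hcK.eq, ← mul_assoc, hK]
  have hsol : ∀ u : ℝ → X, IsSolution (ofBounded A₀) T u →
      ∃ uplus uminus : X, ∀ τ ∈ Icc 0 T, u τ = NormedSpace.exp (τ • (K * A₀)) uplus +
        NormedSpace.exp (τ • -(K * A₀)) uminus := by
    rintro u ⟨v, huv⟩
    refine exists_decomposition hS (fun τ hτ => (huv τ hτ).1) fun τ hτ => ?_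
    obtain ⟨-, _, h⟩ := huv τ hτ
    refine h.congr_deriv ?_
    exact (DFunLike.congr_fun hSS (u τ)).symm
  rw [opSqrt_ofBounded hseg, opProduct_ofBounded, hSS, neg_ofBounded]
  refine ⟨rfl, rfl, _, _, isSemigroupGeneratedBy_exp _, isSemigroupGeneratedBy_exp _, hsol,
    fun r hr u₀ => hsol _ ⟨fun τ => V τ r u₀, fun τ hτ => ⟨hU.deriv τ hτ r hr u₀, ?_⟩⟩⟩
  exact ⟨mem_ofBounded_domain A₀ _, hVd' r hr τ hτ u₀⟩
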